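/- Let $K$ be a finite field whose cardinality is greater than $4$ and is not a prime number. Then there are a prime power $q$ and an integer $n>1$ with $|K|=q^n$, and two polynomials $g,h\in\mathbb F_q[t]$, such that the following holds. (1) The polynomials $g,h$ are $(n,q)$-quasi-symmetric with coefficients in $\mathbb F_q$, i.e. each is of the form $\mathbf f(t,t^q,\dots,t^{q^{n-1}})$ for some $\mathbf f\in\mathbb F_q[X_1,\dots,X_n]$ invariant under the cyclic permutation of the variables; they have no zeros in $K$, and $\deg g=\deg h$. (2) There is a tower of fields $K(x_1)=F_1\subseteq F_2\subseteq F_3\subseteq\cdots$, where $K(x_1)$ is the rational function field and, for every $i\ge 1$, $F_{i+1}=F_i(x_{i+1})$ with $$x_{i+1}^{\frac{q^n-1}{q-1}}=\frac{g(x_i)}{h(x_i)},\qquad \frac{g(x_i)}{h(x_i)}\ne w^{\frac{q^n-1}{q-1}}\ \text{ for all } w\in F_i .$$ (3) Every $F_i$ is a finite separable extension of $K(x_1)$ with full constant field $K$. No place of $F_i$ is wildly ramified over $K(x_1)$ (the characteristic of $K$ divides no ramification index), some place of $F_i$ is ramified over $K(x_1)$ if $i\ge 2$, and every rational place of $K(x_1)$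 (including the pole of $x_1$) splits completely in $F_i$, i.e. has exactly $[F_i:K(x_1)]$ places of $F_i$ above it. (4) The degrees $[F_i:K(x_1)]$ are unbounded. In particular, over every non-prime finite field of cardinality greater than $4$ there exist tamely ramified extensions of the rational function field of arbitrarily high degree in which all rational places split completely. -/

import Mathlib

open Polynomial

namespace FunctionFieldTower

section Places

variable (K : Type*) [Field K] (E : Type*) [Field E] {F : Type*} [Field F] [Algebra K F] [Algebra E F]

/-- The places of the function field `F` over the constant field `K`, each given by its valuation
ring: a valuation ring of `F` that contains `K` and is different from `F`. -/
def places (F : Type*) [Field F] [Algebra K F] : Set (ValuationSubring F) :=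
  {O | O ≠ ⊤ ∧ ∀ a : K, algebraMap K F a ∈ O}

/-- A place is rational (of degree one) if its residue field is `K`, that is, if every element of
its valuation ring is congruent to a constant modulo the maximal ideal. -/
def IsRational (O : ValuationSubring F) : Prop :=
  ∀ z ∈ O, ∃ a : K, z - algebraMap K F a ∈ O.nonunits

/-- The rational places of `F` over `K`. -/
def rationalPlaces (F : Type*) [Field F] [Algebra K F] : Set (ValuationSubring F) :=
  {O | O ∈ places K F ∧ IsRational K O}

/-- The places of `F` that lie above the place `P` of the subfield `E`. -/
def placesAbove (F : Type*) [Field F] [Algebra K F] [Algebra E F] (P : ValuationSubring E) :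
    Set (ValuationSubring F) :=
  {O | O ∈ places K F ∧ O.comap (algebraMap E F) = P}

/-- The ramification index over `E` of the place `O` of `F`: the index of the value group of `E`
in the value group `Fˣ / Oˣ` of `F`, that is, the index of `Eˣ * Oˣ` in `Fˣ`. (The index of a
subgroup is `0` in Lean if it is infinite, which does not happen for places of a finite
extension.) -/
noncomputable def ramificationIndex (O : ValuationSubring F) : ℕ :=
  ((Units.map (algebraMap E F : E →* F)).range ⊔ O.unitGroup).index

/-- No place of `F` is wildly ramified over `E`: the characteristic divides no ramification
index. (The constant fields in this development are finite, so residue field extensions are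
automatically separable.) -/
def IsTame (F : Type*) [Field F] [Algebra K F] [Algebra E F] : Prop :=
  ∀ O ∈ places K F, ¬ ringChar K ∣ ramificationIndex E O

/-- Some place of `F` is ramified over `E`. -/
def IsRamified (F : Type*) [Field F] [Algebra K F] [Algebra E F] : Prop :=
  ∃ O ∈ places K F, 1 < ramificationIndex E O

/-- The place `P` of `E` splits completely in the finite extension `F`: there are exactly
`[F : E]` places of `F` above `P`. -/
def SplitsCompletely (F : Type*) [Field F] [Algebra K F] [Algebra E F]
    (P : ValuationSubring E) : Prop :=
  (placesAbove K E F P).Finite ∧ (placesAbove K E F P).ncard = Module.finrank E F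

/-- `K` is the full constant field of `F`. -/
def IsFullConstantField (F : Type*) [Field F] [Algebra K F] : Prop :=
  ∀ z : F, IsAlgebraic K z → ∃ a : K, algebraMap K F a = z

end Places

section Kummer

variable {K : Type*} [Field K]

/-- `f(t)` is an `(n,q)`-quasi-symmetric polynomial with coefficients in `𝔽_q`: it is the value at
`(t, t^q, …, t^(q^(n-1)))` of a polynomial in `n` variables that is fixed by the cyclic shift of
the variables and has its coefficients in `𝔽_q = {a ∈ K | a ^ q = a}`, where `#K = q ^ n`. -/
def IsQuasiSymmetric (n q : ℕ) (f : K[X]) : Prop :=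
  ∃ s : MvPolynomial (Fin n) K,
    MvPolynomial.rename (finRotate n) s = s ∧
    (∀ m, MvPolynomial.coeff m s ^ q = MvPolynomial.coeff m s) ∧
    MvPolynomial.aeval (fun i : Fin n => (X : K[X]) ^ q ^ (i : ℕ)) s = f

/-- The fields `F 0 ⊆ F 1 ⊆ …` form the Kummer tower over the rational function field `F 0 = K(x)`
given by `F (i+1) = F i (x (i+1))`, `x (i+1) ^ ((q^n-1)/(q-1)) = g (x i) / h (x i)`. -/
structure IsKummerTower (n q : ℕ) (g h : K[X])
    (F : ℕ → IntermediateField (RatFunc K) (AlgebraicClosure (RatFunc K)))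
    (x : ℕ → AlgebraicClosure (RatFunc K)) : Prop where
  quasiSymmetric_num : IsQuasiSymmetric n q g
  quasiSymmetric_den : IsQuasiSymmetric n q h
  num_no_zeros : ∀ a : K, g.eval a ≠ 0
  den_no_zeros : ∀ a : K, h.eval a ≠ 0
  degree_eq : g.degree = h.degree
  field_zero : F 0 = ⊥
  gen_zero : x 0 = algebraMap (RatFunc K) (AlgebraicClosure (RatFunc K)) RatFunc.X
  field_succ : ∀ i, F (i + 1) = F i ⊔ IntermediateField.adjoin (RatFunc K) {x (i + 1)}
  den_ne_zero : ∀ i, aeval (x i) h ≠ 0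
  gen_succ : ∀ i, x (i + 1) ^ ((q ^ n - 1) / (q - 1)) = aeval (x i) g / aeval (x i) h
  not_power : ∀ i, ∀ w ∈ F i, aeval (x i) g / aeval (x i) h ≠ w ^ ((q ^ n - 1) / (q - 1))

end Kummer

end FunctionFieldTower

/-! Let `p` be the characteristic, `q = p`, `Q = p ^ n = #K` and `m = (Q - 1) / (p - 1)`.
Non-primality of `#K` means `n > 1`, so that `m > 1`; also `m` is prime to `p`, and `K` contains the
`m`-th roots of unity. With `u = t ^ Q - t`, take `g = 1 + u ^ p` and `h = 1 + u + u ^ p`.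

Splitting: `u` vanishes on `K` and has a pole wherever `t` does, so `g / h` takes the value `1` at
every `K`-rational value of `t`, including infinity. Hence for any Laurent series `s` over `K` the
quotient `g(s) / h(s)` is a power series with constant term `1`
(`towerDen_ne_zero_and_exists_div_eq`), and Hensel's lemma gives it `m` roots of order `m`. An
embedding of `K(x)` in `K((T))` therefore has `m ^ i` extensions to the `i`-th field
(`HasLifts.exists_injective`). Different extensions give different places
(`IsExpansion.eq_of_comap_eq`), and there are never more than `m ^ i` places. Such an embedding also
shows that the constant field does not grow.

Degree: in characteristic `p`, `g = (1 + u) ^ p`, and `1 + u` has simple zeros because the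
derivative of `u` is `-1`. Starting from such a zero and solving the tower equations backwards over
the algebraic closure, `exists_powerSeries_chain` finds, for each `i`, power series solutions along
which `g(x_i) / h(x_i)` has order exactly `p`. Since `p` is prime to `m`, a norm argument
(`natDegree_minpoly_eq_of_order`) shows that each step has full degree `m`. Full degree in turn
makes homomorphisms extend to the next field, and so the induction runs (`IsTowerSeq.hasLifts`).

Ramification: each step is a Kummer extension of degree `m`, so ramification indices in it divide
`m` and are prime to `p`; multiplicativity of the index carries this up the tower. A zero of order
`p` at the first level, not divisible by `m`, forces ramification. -/

namespace FunctionFieldTower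

/-! ### The numerator and denominator of the tower equation. -/

section Equation

variable {R S : Type*} [CommRing R] [CommRing S]

/-- The value at `t` of the numerator `1 + (t ^ Q - t) ^ p` of the tower equation. -/
def towerNum (p Q : ℕ) (t : R) : R := 1 + (t ^ Q - t) ^ p

/-- The value at `t` of the denominator `1 + (t ^ Q - t) + (t ^ Q - t) ^ p` of the tower
equation. -/
def towerDen (p Q : ℕ) (t : R) : R := 1 + (t ^ Q - t) + (t ^ Q - t) ^ p

lemma map_towerNum {H : Type*} [FunLike H R S] [RingHomClass H R S] (f : H) (p Q : ℕ) (t : R) :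
    f (towerNum p Q t) = towerNum p Q (f t) := by
  simp [towerNum]

lemma map_towerDen {H : Type*} [FunLike H R S] [RingHomClass H R S] (f : H) (p Q : ℕ) (t : R) :
    f (towerDen p Q t) = towerDen p Q (f t) := by
  simp [towerDen]

end Equation

/-! ### Quasi-symmetry and degrees of the two polynomials. -/

section Polynomials

variable (K : Type*) [Field K] (p n : ℕ)

/-- The cyclic polynomial in `n` variables that represents `t ^ p ^ n - t`. -/
noncomputable def cyclicArtinSchreier : MvPolynomial (Fin n) K :=
  ∑ i, MvPolynomial.X i ^ p - ∑ i, MvPolynomial.X i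

lemma rename_cyclicArtinSchreier (e : Fin n ≃ Fin n) :
    MvPolynomial.rename e (cyclicArtinSchreier K p n) = cyclicArtinSchreier K p n := by
  simp only [cyclicArtinSchreier, map_sub, map_sum, map_pow, MvPolynomial.rename_X]
  rw [Equiv.sum_comp e (fun i => (MvPolynomial.X i : MvPolynomial (Fin n) K) ^ p),
    Equiv.sum_comp e (fun i => (MvPolynomial.X i : MvPolynomial (Fin n) K))]

/-- Under `X_i ↦ t ^ p ^ i` each `X_i ^ p` becomes the value of the next variable, so the difference
of the two sums telescopes. -/
lemma aeval_cyclicArtinSchreier :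
    MvPolynomial.aeval (fun i : Fin n => (X : K[X]) ^ p ^ (i : ℕ)) (cyclicArtinSchreier K p n) =
      X ^ p ^ n - X := by
  simp only [cyclicArtinSchreier, map_sub, map_sum, map_pow, MvPolynomial.aeval_X, ← pow_mul,
    ← pow_succ]
  rw [Fin.sum_univ_eq_sum_range (fun i => (X : K[X]) ^ p ^ (i + 1)),
    Fin.sum_univ_eq_sum_range (fun i => (X : K[X]) ^ p ^ i), ← Finset.sum_sub_distrib,
    Finset.sum_range_sub (fun i => (X : K[X]) ^ p ^ i)]
  simp

/-- Integer coefficients land in the prime field, which Frobenius fixes. This is how membership of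
the coefficients in `𝔽_p` is certified. -/
lemma coeff_pow_of_mem_range_map [Fact p.Prime] [CharP K p] {σ : Type*} {s : MvPolynomial σ K}
    (hs : s ∈ (MvPolynomial.map (σ := σ) (Int.castRingHom K)).range) (d : σ →₀ ℕ) :
    MvPolynomial.coeff d s ^ p = MvPolynomial.coeff d s := by
  obtain ⟨s, rfl⟩ := hs
  rw [MvPolynomial.coeff_map, ← frobenius_def]
  simp

lemma cyclicArtinSchreier_mem_range :
    cyclicArtinSchreier K p n ∈ (MvPolynomial.map (σ := Fin n) (Int.castRingHom K)).range :=
  ⟨∑ i, MvPolynomial.X i ^ p - ∑ i, MvPolynomial.X i, by simp [cyclicArtinSchreier]⟩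

variable [Fact p.Prime]

lemma isQuasiSymmetric_towerNum [CharP K p] : IsQuasiSymmetric n p (towerNum p (p ^ n) (X : K[X])) := by
  refine ⟨1 + cyclicArtinSchreier K p n ^ p, ?_, coeff_pow_of_mem_range_map K p ?_, ?_⟩
  · simp [rename_cyclicArtinSchreier]
  · exact add_mem (one_mem _) (pow_mem (cyclicArtinSchreier_mem_range K p n) _)
  · simp [aeval_cyclicArtinSchreier, towerNum]

lemma isQuasiSymmetric_towerDen [CharP K p] : IsQuasiSymmetric n p (towerDen p (p ^ n) (X : K[X])) := by
  refine ⟨1 + cyclicArtinSchreier K p n + cyclicArtinSchreier K p n ^ p, ?_,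
    coeff_pow_of_mem_range_map K p ?_, ?_⟩
  · simp [rename_cyclicArtinSchreier]
  · exact add_mem (add_mem (one_mem _) (cyclicArtinSchreier_mem_range K p n))
      (pow_mem (cyclicArtinSchreier_mem_range K p n) _)
  · simp [aeval_cyclicArtinSchreier, towerDen]

lemma degree_towerNum_eq_degree_towerDen {Q : ℕ} (hQ : 1 < Q) :
    (towerNum p Q (X : K[X])).degree = (towerDen p Q (X : K[X])).degree := by
  have hp := (Fact.out : p.Prime).one_lt
  have hd : ((X : K[X]) ^ Q - X).degree = (Q : WithBot ℕ) := by
    rw [degree_sub_eq_left_of_degree_lt] <;> simp [hQ]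
  have hN : (((X : K[X]) ^ Q - X) ^ p).degree = ((p * Q : ℕ) : WithBot ℕ) := by
    rw [degree_pow, hd]; simp
  have h1 : (1 : K[X]).degree < (((X : K[X]) ^ Q - X) ^ p).degree := by
    rw [hN, degree_one]; exact_mod_cast Nat.mul_pos (by omega) (by omega)
  have h2 : ((1 : K[X]) + (X ^ Q - X)).degree < (((X : K[X]) ^ Q - X) ^ p).degree := by
    rw [degree_add_eq_right_of_degree_lt, hd, hN]
    · exact_mod_cast (by nlinarith : Q < p * Q)
    · rw [hd, degree_one]; exact_mod_cast (by omega : 0 < Q)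
  simp only [towerNum, towerDen]
  rw [degree_add_eq_right_of_degree_lt h1, degree_add_eq_right_of_degree_lt h2]

end Polynomials

/-! ### Backward chains of power series solutions. -/

section PowerSeries

variable {Ω : Type*} [Field Ω]

open PowerSeries in
/-- Hensel's lemma for roots of power series. -/
lemma exists_powerSeries_pow_eq {m : ℕ} (hm : (m : Ω) ≠ 0) (w : Ω⟦X⟧) {a : Ω} (ha : a ≠ 0)
    (haw : a ^ m = constantCoeff w) : ∃ γ : Ω⟦X⟧, γ ^ m = w ∧ constantCoeff γ = a := by
  have hm0 : m ≠ 0 := by rintro rfl; simp at hm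
  have hmem (f : Ω⟦X⟧) : f ∈ Ideal.span {(PowerSeries.X : Ω⟦X⟧)} ↔ constantCoeff f = 0 := by
    rw [Ideal.mem_span_singleton, PowerSeries.X_dvd_iff]
  obtain ⟨γ, h1, h2⟩ := HenselianRing.is_henselian (I := Ideal.span {(PowerSeries.X : Ω⟦X⟧)})
    (Polynomial.X ^ m - Polynomial.C w) (monic_X_pow_sub_C w hm0) (PowerSeries.C a)
    (by rw [hmem]; simp [haw])
    (by
      refine IsUnit.map _ ?_
      rw [isUnit_iff_constantCoeff]
      simp only [derivative_sub, derivative_X_pow, Polynomial.derivative_C, sub_zero, eval_mul, eval_pow,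
        eval_X, map_mul, map_pow, isUnit_iff_ne_zero]
      simp [hm, ha])
  rw [hmem] at h2
  exact ⟨γ, by simpa [IsRoot, sub_eq_zero] using h1, by simpa [sub_eq_zero] using h2⟩

variable (p : ℕ) [Fact p.Prime] {n m : ℕ}

lemma towerNum_eq_pow {R : Type*} [CommRing R] [CharP R p] (Q : ℕ) (t : R) :
    towerNum p Q t = (1 + (t ^ Q - t)) ^ p := by
  rw [towerNum, add_pow_char, one_pow]

/-- Denominator minus numerator is `u = α ^ Q - α`. If the denominator vanished, so would the
numerator, hence `u = 0`; but then the denominator is `1`. -/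
lemma towerDen_ne_zero_of_pow_mul_eq {c α : Ω} {Q : ℕ} (h : c * towerDen p Q α = towerNum p Q α) :
    towerDen p Q α ≠ 0 := by
  intro h0
  have hp := (Fact.out : p.Prime).ne_zero
  have h1 : α ^ Q - α = 0 := by
    have : α ^ Q - α = towerDen p Q α - towerNum p Q α := by simp only [towerDen, towerNum]; ring
    rw [this, ← h, h0]; simp
  simp [towerDen, h1, hp] at h0

/-- Outside the field with `p ^ n` elements the tower equation can be solved backwards. -/
lemma exists_mul_towerDen_eq [IsAlgClosed Ω] (hn : n ≠ 0) (hm : m ∣ p ^ n - 1) {α : Ω} (hα : α ^ p ^ n - α ≠ 0) :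
    ∃ α' : Ω, α' ^ p ^ n - α' ≠ 0 ∧ α ^ m * towerDen p (p ^ n) α' = towerNum p (p ^ n) α' := by
  have hp := (Fact.out : p.Prime).one_lt
  have hQ : 1 < p ^ n := Nat.one_lt_pow hn hp
  set c := α ^ m
  -- `α ^ m = 1` would give `α ^ (p ^ n - 1) = 1`, placing `α` in the field with `p ^ n` elements.
  have hc : 1 - c ≠ 0 := by
    intro h
    obtain ⟨k, hk⟩ := hm
    apply hα
    have h1 : α ^ (p ^ n - 1) = 1 := by rw [hk, pow_mul]; change c ^ k = 1; simp [← sub_eq_zero.1 h]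
    have : α ^ p ^ n = α := by
      rw [show p ^ n = (p ^ n - 1) + 1 by omega, pow_succ, h1, one_mul]
    rw [this, sub_self]
  -- Here `b` plays the role of `α' ^ p ^ n - α'`: the polynomial is `c * (1 + b + b ^ p) = 1 + b ^
  -- p` rearranged. Its constant term `1 - c` is nonzero, which keeps `b`, and so `α'`, out of the
  -- bad set.
  obtain ⟨b, hb⟩ := IsAlgClosed.exists_root
    (Polynomial.C (1 - c) * Polynomial.X ^ p + (Polynomial.C (-c) * Polynomial.X + Polynomial.C (1 - c)))
    (by
      rw [degree_add_eq_left_of_degree_lt]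
      · rw [degree_C_mul_X_pow _ hc]; exact_mod_cast (by omega : p ≠ 0)
      · rw [degree_C_mul_X_pow _ hc]
        exact lt_of_le_of_lt degree_linear_le (by exact_mod_cast hp))
  simp only [IsRoot, eval_add, eval_mul, eval_C, eval_pow, eval_X] at hb
  have hb0 : b ≠ 0 := by
    rintro rfl
    rw [zero_pow (by omega)] at hb
    apply hc
    linear_combination hb
  obtain ⟨α', hα'⟩ := IsAlgClosed.exists_root
    (Polynomial.X ^ p ^ n + (Polynomial.C (-1) * Polynomial.X + Polynomial.C (-b)))
    (by
      rw [degree_add_eq_left_of_degree_lt]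
      · rw [degree_X_pow]; exact_mod_cast (by omega : p ^ n ≠ 0)
      · rw [degree_X_pow]
        exact lt_of_le_of_lt degree_linear_le (by exact_mod_cast hQ))
  simp only [IsRoot, eval_add, eval_mul, eval_C, eval_pow, eval_X] at hα'
  have hα'' : α' ^ p ^ n - α' = b := by linear_combination hα'
  refine ⟨α', hα'' ▸ hb0, ?_⟩
  rw [towerDen, towerNum, hα'']
  linear_combination -hb

open PowerSeries in
/-- For every length `k` there are solutions of the first `k` tower equations in power series
such that the right hand side of the next equation has order `p`. -/
theorem exists_powerSeries_chain [CharP Ω p] [IsAlgClosed Ω] (hn : n ≠ 0) (hm : m ∣ p ^ n - 1) (hmp : (m : Ω) ≠ 0) (k : ℕ) :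
    ∃ α : Ω, α ^ p ^ n - α ≠ 0 ∧ ∀ b : Ω⟦X⟧, constantCoeff b = α → coeff 1 b ≠ 0 →
      ∃ β : ℕ → Ω⟦X⟧, β 0 = b ∧
        (∀ j < k, β (j + 1) ^ m * towerDen p (p ^ n) (β j) = towerNum p (p ^ n) (β j)) ∧
        (∀ j ≤ k, IsUnit (towerDen p (p ^ n) (β j))) ∧
        ∃ r : Ω⟦X⟧, IsUnit r ∧ towerNum p (p ^ n) (β k) = PowerSeries.X ^ p * r := by
  have hp := (Fact.out : p.Prime).one_lt
  have hQ : 1 < p ^ n := Nat.one_lt_pow hn hp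
  have : CharP Ω⟦X⟧ p := charP_of_injective_ringHom (f := PowerSeries.C) C_injective p
  have hQ0 : ((p ^ n : ℕ) : Ω⟦X⟧) = 0 := by
    rw [Nat.cast_pow, CharP.cast_eq_zero, zero_pow hn]
  have hder (b : Ω⟦X⟧) : d⁄dX Ω (b ^ p ^ n - b) = - d⁄dX Ω b := by
    rw [map_sub, Derivation.leibniz_pow]
    rw [← Nat.cast_smul_eq_nsmul Ω⟦X⟧, hQ0]; simp
  have hcd (b : Ω⟦X⟧) : constantCoeff (d⁄dX Ω b) = coeff 1 b := by
    rw [← coeff_zero_eq_constantCoeff_apply, PowerSeries.coeff_derivative]; simp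
  have hpow (f : Ω⟦X⟧) : d⁄dX Ω (f ^ p) = 0 := by
    rw [Derivation.leibniz_pow, ← Nat.cast_smul_eq_nsmul Ω⟦X⟧, CharP.cast_eq_zero]; simp
  induction k with
  | zero =>
    -- A zero of `1 + (t ^ Q - t)`. It is simple because the derivative is `-1`, so the numerator,
    -- its `p`-th power, has order exactly `p` there.
    obtain ⟨α, hα⟩ := IsAlgClosed.exists_root
      (Polynomial.X ^ p ^ n + (Polynomial.C (-1 : Ω) * Polynomial.X + Polynomial.C 1))
      (by
        rw [degree_add_eq_left_of_degree_lt]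
        · rw [degree_X_pow]; exact_mod_cast (by omega : p ^ n ≠ 0)
        · rw [degree_X_pow]
          exact lt_of_le_of_lt degree_linear_le (by exact_mod_cast hQ))
    simp only [IsRoot, eval_add, eval_mul, eval_C, eval_pow, eval_X] at hα
    have hα' : α ^ p ^ n - α = -1 := by linear_combination hα
    refine ⟨α, by simp [hα'], fun b hb0 hb1 => ⟨fun _ => b, rfl, by simp, fun j _ => ?_, ?_⟩⟩
    · rw [isUnit_iff_constantCoeff, map_towerDen, hb0, towerDen, hα', isUnit_iff_ne_zero]
      simp
    · have h0 : PowerSeries.constantCoeff (1 + (b ^ p ^ n - b)) = 0 := by simp [hb0, hα']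
      obtain ⟨r, hr⟩ := PowerSeries.X_dvd_iff.2 h0
      refine ⟨r ^ p, IsUnit.pow _ ?_, ?_⟩
      · rw [isUnit_iff_constantCoeff, isUnit_iff_ne_zero]
        have h1 := congrArg (PowerSeries.coeff 1) hr
        rw [← hcd, map_add, hder, Derivation.map_one_eq_zero] at h1
        rw [← coeff_zero_eq_constantCoeff_apply, ← coeff_succ_X_mul 0 r, zero_add, ← h1]
        simpa [hcd] using hb1
      · rw [towerNum_eq_pow, hr, mul_pow]
  | succ k ih =>
    obtain ⟨α, hα, H⟩ := ih
    -- The chain grows at its front: the new series `b` starts at `α'`, its successor `γ` starts at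
    -- `α`, and the induction hypothesis, valid for every series through `α` with nonzero linear
    -- term, supplies the rest.
    obtain ⟨α', hα', heq⟩ := exists_mul_towerDen_eq p hn hm hα
    refine ⟨α', hα', fun b hb0 hb1 => ?_⟩
    have hden : IsUnit (towerDen p (p ^ n) b) := by
      rw [isUnit_iff_constantCoeff, map_towerDen, hb0, isUnit_iff_ne_zero]
      exact towerDen_ne_zero_of_pow_mul_eq p heq
    have hα0 : α ≠ 0 := by
      rintro rfl
      exact hα (by rw [zero_pow (by omega), sub_zero])
    obtain ⟨d, hd⟩ := hden
    obtain ⟨γ, hγ, hγ0⟩ := exists_powerSeries_pow_eq hmp (towerNum p (p ^ n) b * ↑d⁻¹) hα0 (by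
      have h1 : constantCoeff (towerDen p (p ^ n) b) * constantCoeff (↑d⁻¹ : Ω⟦X⟧) = 1 := by
        rw [← hd, ← map_mul]; simp
      rw [map_mul, map_towerNum, hb0, ← heq, mul_assoc, ← hb0, ← map_towerDen, h1, mul_one])
    have hγd : γ ^ m * towerDen p (p ^ n) b = towerNum p (p ^ n) b := by
      rw [hγ, ← hd]; simp [mul_assoc]
    -- Differentiate `γ ^ m * h(b) = g(b)`: `g(b)` has derivative `0` and `h(b)` has derivative
    -- `-b'`. If `γ` had no linear term, the constant coefficients would give `α ^ m * b' = 0`.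
    obtain ⟨β, h0, h1, h2, h3⟩ := H γ hγ0 (by
      have h1 := congrArg (fun f => constantCoeff (d⁄dX Ω f)) hγd
      intro h
      simp only [towerNum, towerDen, map_add, Derivation.leibniz, hpow, hder,
        Derivation.map_one_eq_zero, Derivation.leibniz_pow, smul_eq_mul, map_mul, map_neg, hcd, h,
        hγ0, map_nsmul, map_pow] at h1
      simp [hα0, hb1] at h1)
    refine ⟨fun j => Nat.casesOn j b β, rfl, ?_, ?_, h3⟩
    · rintro (_ | j) hj
      · simpa [h0] using hγd
      · exact h1 j (by omega)
    · rintro (_ | j) hj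
      · exact ⟨d, hd⟩
      · exact h2 j (by omega)

end PowerSeries

/-! ### Orders of Laurent series coming from power series. -/

section Order

variable {Ω : Type*} [Field Ω]

lemma order_algebraMap_nonneg (f : PowerSeries Ω) :
    0 ≤ (algebraMap (PowerSeries Ω) (LaurentSeries Ω) f).order := by
  by_contra! h
  have h0 : algebraMap (PowerSeries Ω) (LaurentSeries Ω) f ≠ 0 := by
    intro h0
    simp [h0] at h
  apply HahnSeries.coeff_order_eq_zero.not.2 h0
  set k := (algebraMap (PowerSeries Ω) (LaurentSeries Ω) f).order
  rw [LaurentSeries.coe_algebraMap, PowerSeries.coeff_coe, if_pos h]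

lemma order_algebraMap_of_isUnit {f : PowerSeries Ω} (hf : IsUnit f) :
    (algebraMap (PowerSeries Ω) (LaurentSeries Ω) f).order = 0 := by
  obtain ⟨g, hg⟩ := isUnit_iff_exists_inv.1 hf
  have h : algebraMap (PowerSeries Ω) (LaurentSeries Ω) f *
      algebraMap (PowerSeries Ω) (LaurentSeries Ω) g = 1 := by rw [← map_mul, hg, map_one]
  have h1 := congrArg HahnSeries.order h
  rw [HahnSeries.order_mul (left_ne_zero_of_mul_eq_one h) (right_ne_zero_of_mul_eq_one h),
    HahnSeries.order_one] at h1
  have := order_algebraMap_nonneg f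
  have := order_algebraMap_nonneg g
  omega

lemma order_algebraMap_X_pow_mul (k : ℕ) {f : PowerSeries Ω} (hf : IsUnit f) :
    (algebraMap (PowerSeries Ω) (LaurentSeries Ω) (PowerSeries.X ^ k * f)).order = k := by
  have hX : algebraMap (PowerSeries Ω) (LaurentSeries Ω) PowerSeries.X ≠ 0 := by
    simp [LaurentSeries.coe_algebraMap]
  rw [map_mul, map_pow, HahnSeries.order_mul (pow_ne_zero _ hX) (hf.map _).ne_zero,
    order_algebraMap_of_isUnit hf, HahnSeries.order_pow, LaurentSeries.coe_algebraMap,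
    HahnSeries.ofPowerSeries_X, HahnSeries.order_single one_ne_zero]
  simp

lemma order_div_eq {p : ℕ} {f g : PowerSeries Ω} {r : PowerSeries Ω} (hr : IsUnit r)
    (hf : f = PowerSeries.X ^ p * r) (hg : IsUnit g) :
    (algebraMap (PowerSeries Ω) (LaurentSeries Ω) f /
      algebraMap (PowerSeries Ω) (LaurentSeries Ω) g).order = p := by
  obtain ⟨d, rfl⟩ := hg
  have h : algebraMap (PowerSeries Ω) (LaurentSeries Ω) f /
      algebraMap (PowerSeries Ω) (LaurentSeries Ω) (d : PowerSeries Ω) =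
      algebraMap (PowerSeries Ω) (LaurentSeries Ω) (PowerSeries.X ^ p * (r * (↑d⁻¹ : PowerSeries Ω))) := by
    rw [div_eq_iff (d.isUnit.map _).ne_zero, ← map_mul, hf]
    rw [mul_assoc, mul_assoc, Units.inv_mul, mul_one]
  rw [h, order_algebraMap_X_pow_mul _ (hr.mul d⁻¹.isUnit)]

end Order

/-! ### Radical extensions: degree and extension of homomorphisms. -/

section PowExtension

variable {E C M : Type*} [Field E] [Field C] [Algebra E C] [Field M]

lemma isIntegral_of_pow_mem (F : IntermediateField E C) {y : C} {m : ℕ} (hm : 0 < m)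
    (hy : y ^ m ∈ F) : IsIntegral F y :=
  IsIntegral.of_pow hm (isIntegral_algebraMap (x := (⟨y ^ m, hy⟩ : F)))

lemma minpoly_dvd_X_pow_sub_C (F : IntermediateField E C) {y : C} {m : ℕ}
    (hy : y ^ m ∈ F) : minpoly F y ∣ X ^ m - Polynomial.C (⟨y ^ m, hy⟩ : F) := by
  apply minpoly.dvd
  rw [map_sub, map_pow, aeval_X, aeval_C]
  exact sub_self _

lemma minpoly_eq_X_pow_sub_C (F : IntermediateField E C) {y : C} {m : ℕ} (hm : 0 < m)
    (hy : y ^ m ∈ F) (hdeg : (minpoly F y).natDegree = m) :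
    minpoly F y = X ^ m - Polynomial.C (⟨y ^ m, hy⟩ : F) := by
  refine (eq_of_monic_of_dvd_of_natDegree_le (minpoly.monic (isIntegral_of_pow_mem F hm hy))
    (monic_X_pow_sub_C _ hm.ne') (minpoly_dvd_X_pow_sub_C F hy) ?_).symm
  rw [natDegree_X_pow_sub_C, hdeg]

/-- A homomorphism extends to a radical extension of full degree, with a prescribed root. -/
lemma exists_ringHom_sup_adjoin (F : IntermediateField E C) {y : C} {m : ℕ} (hm : 0 < m)
    (hy : y ^ m ∈ F) (hdeg : (minpoly F y).natDegree = m) (Φ : F →+* M) {η : M}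
    (hη : η ^ m = Φ ⟨y ^ m, hy⟩) :
    ∃ Φ' : ↥(F ⊔ IntermediateField.adjoin E {y}) →+* M,
      (∀ z (hz : z ∈ F) hz', Φ' ⟨z, hz'⟩ = Φ ⟨z, hz⟩) ∧ ∀ hy', Φ' ⟨y, hy'⟩ = η := by
  have hint := isIntegral_of_pow_mem F hm hy
  let _ := Φ.toAlgebra
  have hroot : η ∈ (minpoly F y).aroots M := by
    rw [mem_aroots]
    refine ⟨minpoly.ne_zero hint, ?_⟩
    rw [minpoly_eq_X_pow_sub_C F hm hy hdeg, map_sub, map_pow, aeval_X, aeval_C, hη]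
    exact sub_self _
  let f := (IntermediateField.algHomAdjoinIntegralEquiv F (K := M) hint).symm ⟨η, hroot⟩
  rw [← IntermediateField.restrictScalars_adjoin_eq_sup]
  refine ⟨f.toRingHom, fun z hz hz' => f.commutes ⟨z, hz⟩, fun hy' => ?_⟩
  exact IntermediateField.algHomAdjoinIntegralEquiv_symm_apply_gen F hint ⟨η, hroot⟩

/-- Take the norm of `y` down to `F`. With `d` the degree, `N(y) ^ m = (y ^ m) ^ d`, and comparing
orders under `Φ` gives `m ∣ d * p`, hence `m ∣ d`; also `d ≤ m`. No extension of `Φ` to `F(y)` is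
needed. -/
lemma natDegree_minpoly_eq_of_order {Ω : Type*} [Field Ω] (F : IntermediateField E C) {y : C}
    {m p : ℕ} (hm : 0 < m) (hmp : m.Coprime p) (hy : y ^ m ∈ F) (Φ : F →+* LaurentSeries Ω)
    (hΦ : (Φ ⟨y ^ m, hy⟩).order = p) : (minpoly F y).natDegree = m := by
  have hint := isIntegral_of_pow_mem F hm hy
  set d := (minpoly F y).natDegree with hd
  have hdpos : 0 < d := minpoly.natDegree_pos hint
  have hdm : d ≤ m := by
    have := natDegree_le_of_dvd (minpoly_dvd_X_pow_sub_C F hy) (monic_X_pow_sub_C _ hm.ne').ne_zero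
    rwa [natDegree_X_pow_sub_C] at this
  have hg : (IntermediateField.AdjoinSimple.gen F y) ^ m =
      algebraMap F (IntermediateField.adjoin F {y}) ⟨y ^ m, hy⟩ := by
    ext; rfl
  have hN := congrArg (Algebra.norm F) hg
  rw [map_pow, Algebra.norm_algebraMap, IntermediateField.adjoin.finrank hint, ← hd] at hN
  have hN' := congrArg (fun z => HahnSeries.order (Φ z)) hN
  simp only [map_pow Φ] at hN'
  rw [HahnSeries.order_pow, HahnSeries.order_pow, hΦ] at hN'
  have h1 : (m : ℤ) ∣ (d * p : ℕ) :=
    ⟨_, by rw [nsmul_eq_mul, nsmul_eq_mul] at hN'; push_cast; exact hN'.symm⟩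
  have h2 : m ∣ d := hmp.dvd_of_dvd_mul_right (Int.natCast_dvd_natCast.1 h1)
  exact le_antisymm hdm (Nat.le_of_dvd hdpos h2)

end PowExtension

/-! ### The tower of fields and lifting of solutions of its equations. -/

section Tower

variable {E C : Type*} [Field E] [Field C] [Algebra E C]

/-- The fields `E ⊆ E(x 1) ⊆ E(x 1, x 2) ⊆ …`. -/
def towerField (E : Type*) {C : Type*} [Field E] [Field C] [Algebra E C] (x : ℕ → C) :
    ℕ → IntermediateField E C
  | 0 => ⊥
  | i + 1 => towerField E x i ⊔ IntermediateField.adjoin E {x (i + 1)}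

lemma towerField_le_succ (x : ℕ → C) (i : ℕ) : towerField E x i ≤ towerField E x (i + 1) :=
  le_sup_left

lemma gen_mem_towerField {x : ℕ → C} {t : E} (h0 : x 0 = algebraMap E C t) {i j : ℕ}
    (hij : j ≤ i) : x j ∈ towerField E x i := by
  induction i with
  | zero =>
    obtain rfl : j = 0 := by omega
    rw [h0]; exact algebraMap_mem _ _
  | succ i ih =>
    rcases hij.lt_or_eq with h | rfl
    · exact towerField_le_succ x i (ih (by omega))
    · exact (le_sup_right : _ ≤ towerField E x (i + 1)) (IntermediateField.mem_adjoin_simple_self _ _)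

/-- The sequence `x` solves the tower equations `x (i + 1) ^ m = g (x i) / h (x i)`. -/
structure IsTowerSeq (p Q m : ℕ) (t : E) (x : ℕ → C) : Prop where
  zero : x 0 = algebraMap E C t
  succ : ∀ i, x (i + 1) ^ m = towerNum p Q (x i) / towerDen p Q (x i)

lemma exists_isTowerSeq [IsAlgClosed C] (p Q : ℕ) {m : ℕ} (hm : 0 < m) (t : E) :
    ∃ x : ℕ → C, IsTowerSeq p Q m t x := by
  choose r hr using fun z : C => IsAlgClosed.exists_pow_nat_eq z hm
  exact ⟨fun i => Nat.rec (algebraMap E C t) (fun _ z => r (towerNum p Q z / towerDen p Q z)) i,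
    rfl, fun i => hr _⟩

variable {p Q m : ℕ} {t : E} {x : ℕ → C}

lemma IsTowerSeq.gen_pow_mem (hx : IsTowerSeq p Q m t x) (i : ℕ) :
    x (i + 1) ^ m ∈ towerField E x i := by
  have h := gen_mem_towerField hx.zero (le_refl i)
  have h1 : towerNum p Q (x i) ∈ towerField E x i :=
    add_mem (one_mem _) (pow_mem (sub_mem (pow_mem h _) h) _)
  have h2 : towerDen p Q (x i) ∈ towerField E x i :=
    add_mem (add_mem (one_mem _) (sub_mem (pow_mem h _) h)) (pow_mem (sub_mem (pow_mem h _) h) _)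
  rw [hx.succ]
  exact div_mem h1 h2

/-- Every solution of the tower equations is the image of `x` under a homomorphism. -/
def HasLifts.{u} (E : Type u) {C : Type*} [Field E] [Field C] [Algebra E C]
    (p Q m : ℕ) (t : E) (x : ℕ → C) (i : ℕ) : Prop :=
  ∀ (M : Type u) [Field M] (ψ : E →+* M) (β : ℕ → M), β 0 = ψ t →
    (∀ j < i, β (j + 1) ^ m = towerNum p Q (β j) / towerDen p Q (β j)) →
    ∃ Φ : towerField E x i →+* M, (∀ e, Φ (algebraMap E _ e) = ψ e) ∧
      ∀ j ≤ i, ∀ hj, Φ ⟨x j, hj⟩ = β j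

lemma IsTowerSeq.map_gen_pow (hx : IsTowerSeq p Q m t x) {i : ℕ} {M : Type*} [Field M]
    (Φ : towerField E x i →+* M) {b : M} (hb : ∀ h, Φ ⟨x i, h⟩ = b) :
    Φ ⟨x (i + 1) ^ m, hx.gen_pow_mem i⟩ = towerNum p Q b / towerDen p Q b := by
  have h := gen_mem_towerField hx.zero (le_refl i)
  rw [← hb h, ← map_towerNum, ← map_towerDen, ← map_div₀]
  congr 1
  ext
  change x (i + 1) ^ m = _
  rw [hx.succ]
  simp [towerNum, towerDen]

lemma hasLifts_zero (hx : IsTowerSeq p Q m t x) : HasLifts E p Q m t x 0 := by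
  intro M _ ψ β h0 _
  refine ⟨ψ.comp (IntermediateField.botEquiv E C).toRingEquiv.toRingHom, fun e => ?_, ?_⟩
  · change ψ ((IntermediateField.botEquiv E C) (algebraMap E _ e)) = ψ e
    simp
  · intro j hj hmem
    obtain rfl : j = 0 := by omega
    have : (⟨x 0, hmem⟩ : towerField E x 0) = algebraMap E _ t := by ext; exact hx.zero
    rw [this, h0]
    change ψ ((IntermediateField.botEquiv E C) (algebraMap E _ t)) = ψ t
    simp

lemma hasLifts_succ (hx : IsTowerSeq p Q m t x) (hm : 0 < m) {i : ℕ}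
    (hdeg : (minpoly (towerField E x i) (x (i + 1))).natDegree = m)
    (h : HasLifts E p Q m t x i) : HasLifts E p Q m t x (i + 1) := by
  intro M _ ψ β h0 hβ
  obtain ⟨Φ, h1, h2⟩ := h M ψ β h0 fun j hj => hβ j (by omega)
  obtain ⟨Φ', h3, h4⟩ := exists_ringHom_sup_adjoin (towerField E x i) hm (hx.gen_pow_mem i) hdeg Φ
    (η := β (i + 1)) (by rw [hx.map_gen_pow Φ (h2 i le_rfl), hβ i (by omega)])
  refine ⟨Φ', fun e => ?_, fun j hj hmem => ?_⟩
  · rw [← h1 e]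
    exact h3 (algebraMap E C e) (algebraMap_mem _ _) _
  · rcases hj.lt_or_eq with hj | rfl
    · rw [← h2 j (by omega) (gen_mem_towerField hx.zero (by omega))]
      exact h3 _ _ _
    · exact h4 _

end Tower

/-! ### Full degree at every step. -/

section Chain

universe u

/-- Generic power series for the variable `t` of the field `E`: every power series with
nonvanishing linear coefficient is the image of `t` under a homomorphism. -/
def HasSeriesHoms (E : Type u) [Field E] (t : E) (Ω : Type u) [Field Ω] : Prop :=
  ∀ b : PowerSeries Ω, PowerSeries.coeff 1 b ≠ 0 → ∃ ψ : E →+* LaurentSeries Ω,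
    ψ t = algebraMap (PowerSeries Ω) (LaurentSeries Ω) b

variable {E : Type u} {C : Type*} [Field E] [Field C] [Algebra E C] {p n m : ℕ} [Fact p.Prime]
  {t : E} {x : ℕ → C} (Ω : Type u) [Field Ω] [CharP Ω p] [IsAlgClosed Ω]

/-- Every field of the tower has a place at which the right hand side of the next equation has
value `p`. -/
lemma HasLifts.exists_order_eq (hΩ : HasSeriesHoms E t Ω) (hn : n ≠ 0) (hm : m ∣ p ^ n - 1)
    (hmp : (m : Ω) ≠ 0) {i : ℕ} (h : HasLifts E p (p ^ n) m t x i) :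
    ∃ (Φ : towerField E x i →+* LaurentSeries Ω) (b : LaurentSeries Ω),
      (∀ h, Φ ⟨x i, h⟩ = b) ∧ towerDen p (p ^ n) b ≠ 0 ∧
      (towerNum p (p ^ n) b / towerDen p (p ^ n) b).order = p := by
  obtain ⟨α, -, H⟩ := exists_powerSeries_chain (Ω := Ω) p hn hm hmp i
  obtain ⟨β, h0, h1, h2, r, hr, h3⟩ := H (PowerSeries.C α + PowerSeries.X) (by simp) (by simp)
  obtain ⟨ψ, hψ⟩ := hΩ (PowerSeries.C α + PowerSeries.X) (by simp)
  have hunit (j : ℕ) (hj : j ≤ i) : towerDen p (p ^ n)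
      (algebraMap (PowerSeries Ω) (LaurentSeries Ω) (β j)) ≠ 0 := by
    rw [← map_towerDen]
    exact ((h2 j hj).map _).ne_zero
  obtain ⟨Φ, -, hΦ⟩ := h (LaurentSeries Ω) ψ
    (fun j => algebraMap (PowerSeries Ω) (LaurentSeries Ω) (β j)) (by simp only [h0, hψ])
    (fun j hj => by
      rw [eq_div_iff (hunit j hj.le), ← map_towerNum, ← map_towerDen, ← h1 j hj, map_mul, map_pow])
  refine ⟨Φ, _, hΦ i le_rfl, hunit i le_rfl, ?_⟩
  rw [← map_towerNum, ← map_towerDen]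
  exact order_div_eq hr h3 (h2 i le_rfl)

variable (hΩ : HasSeriesHoms E t Ω) (hn : n ≠ 0) (hm : m ∣ p ^ n - 1) (hmp : (m : Ω) ≠ 0)
  (hm0 : 0 < m) (hmc : m.Coprime p) (hx : IsTowerSeq p (p ^ n) m t x)

include hΩ hn hm hmp hm0 hmc hx

lemma IsTowerSeq.natDegree_of_hasLifts {i : ℕ} (h : HasLifts E p (p ^ n) m t x i) :
    (minpoly (towerField E x i) (x (i + 1))).natDegree = m := by
  obtain ⟨Φ, b, h1, -, h3⟩ := h.exists_order_eq Ω hΩ hn hm hmp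
  exact natDegree_minpoly_eq_of_order _ hm0 hmc (hx.gen_pow_mem i) Φ (by rw [hx.map_gen_pow Φ h1, h3])

/-- Lifts and degrees are proved in alternation: lifts to level `i` realise the power series chain
inside that field, which forces degree `m` for the next step, which provides the lifts to level `i +
1`. -/
theorem IsTowerSeq.hasLifts (i : ℕ) : HasLifts E p (p ^ n) m t x i := by
  induction i with
  | zero => exact hasLifts_zero hx
  | succ i ih =>
    exact hasLifts_succ hx hm0 (hx.natDegree_of_hasLifts Ω hΩ hn hm hmp hm0 hmc ih) ih

theorem IsTowerSeq.natDegree_minpoly (i : ℕ) :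
    (minpoly (towerField E x i) (x (i + 1))).natDegree = m :=
  hx.natDegree_of_hasLifts Ω hΩ hn hm hmp hm0 hmc (hx.hasLifts Ω hΩ hn hm hmp hm0 hmc i)

theorem IsTowerSeq.towerDen_ne_zero (i : ℕ) : towerDen p (p ^ n) (x i) ≠ 0 := by
  obtain ⟨Φ, b, h1, h2, -⟩ := (hx.hasLifts Ω hΩ hn hm hmp hm0 hmc i).exists_order_eq Ω hΩ hn hm hmp
  have h := gen_mem_towerField hx.zero (le_refl i)
  intro h0
  apply h2
  rw [← h1 h, ← map_towerDen, map_eq_zero]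
  ext
  simpa [towerDen] using h0

/-- An `m`-th power has order divisible by `m`, but the order here is `p`, prime to `m`. -/
theorem IsTowerSeq.not_pow (hm1 : m ≠ 1) (i : ℕ) {w : C} (hw : w ∈ towerField E x i) :
    towerNum p (p ^ n) (x i) / towerDen p (p ^ n) (x i) ≠ w ^ m := by
  obtain ⟨Φ, b, h1, -, h3⟩ := (hx.hasLifts Ω hΩ hn hm hmp hm0 hmc i).exists_order_eq Ω hΩ hn hm hmp
  rw [← hx.map_gen_pow Φ h1] at h3
  rw [← hx.succ]
  intro h
  have h4 : (⟨x (i + 1) ^ m, hx.gen_pow_mem i⟩ : towerField E x i) = ⟨w, hw⟩ ^ m := by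
    ext; exact h
  rw [h4, map_pow, HahnSeries.order_pow, nsmul_eq_mul] at h3
  have h5 : m ∣ p := Int.natCast_dvd_natCast.1 ⟨_, h3.symm⟩
  exact hm1 (Nat.Coprime.eq_one_of_dvd hmc h5)

theorem IsTowerSeq.finrank_towerField (i : ℕ) :
    Module.finrank E (towerField E x i) = m ^ i := by
  induction i with
  | zero => rw [pow_zero]; exact IntermediateField.finrank_bot
  | succ i ih =>
    rw [towerField, ← IntermediateField.restrictScalars_adjoin_eq_sup]
    change Module.finrank E (IntermediateField.adjoin (towerField E x i) {x (i + 1)}) = _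
    rw [← Module.finrank_mul_finrank E (towerField E x i), ih, pow_succ,
      IntermediateField.adjoin.finrank (isIntegral_of_pow_mem _ hm0 (hx.gen_pow_mem i)),
      hx.natDegree_minpoly Ω hΩ hn hm hmp hm0 hmc i]

theorem IsTowerSeq.finiteDimensional_towerField (i : ℕ) :
    FiniteDimensional E (towerField E x i) := by
  refine Module.finite_of_finrank_pos ?_
  rw [hx.finrank_towerField Ω hΩ hn hm hmp hm0 hmc i]
  exact pow_pos hm0 _

end Chain

open IsDedekindDomain HeightOneSpectrum

/-! ### Valuation rings over Dedekind domains and in algebraic extensions. -/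

section Dedekind

variable {B L : Type*} [CommRing B] [IsDedekindDomain B] [Field L] [Algebra B L]
  [IsFractionRing B L] {O : ValuationSubring L}

/-- A nontrivial valuation ring that contains a Dedekind domain with the same field of fractions
is the valuation ring of a maximal ideal. -/
theorem exists_heightOneSpectrum_valuationSubring (hB : ∀ b : B, algebraMap B L b ∈ O)
    (hO : O ≠ ⊤) : ∃ w : HeightOneSpectrum B, (w.valuation L).valuationSubring = O ∧
      ∀ b, b ∈ w.asIdeal ↔ algebraMap B L b ∈ O.nonunits := by
  let f : B →+* O := (algebraMap B L).codRestrict O.toSubring hB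
  let I := (IsLocalRing.maximalIdeal O).comap f
  have hI (b : B) : b ∈ I ↔ algebraMap B L b ∈ O.nonunits := by
    rw [Ideal.mem_comap, ← ValuationSubring.coe_mem_nonunits_iff]; rfl
  have hinv {b : B} (hb : b ∉ I) : (algebraMap B L b)⁻¹ ∈ O := by
    rw [hI, ValuationSubring.mem_nonunits_iff_or, not_or, not_not] at hb
    exact hb.2
  have hbot : I ≠ ⊥ := by
    intro h
    apply hO
    rw [eq_top_iff]
    intro z _
    obtain ⟨a, b, hb, rfl⟩ := IsFractionRing.div_surjective (A := B) z
    rw [div_eq_mul_inv]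
    refine O.mul_mem _ _ (hB a) (hinv ?_)
    rw [h, Ideal.mem_bot]
    exact nonZeroDivisors.ne_zero hb
  let w : HeightOneSpectrum B := ⟨I, Ideal.IsPrime.comap f, hbot⟩
  refine ⟨w, ?_, hI⟩
  rw [← valuationSubringAtPrime_eq_valuationSubring]
  -- The local ring at `w` is a maximal proper subring of `L`, so one inclusion suffices.
  refine ValuationSubring.eq_of_le_of_ne_top _ ?_ hO
  rintro x ⟨a, s, hs, rfl⟩
  exact O.mul_mem _ _ (hB a) (hinv hs)

lemma isDiscreteValuationRing_valuationSubring (w : HeightOneSpectrum B) :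
    IsDiscreteValuationRing (w.valuation L).valuationSubring := by
  rw [← valuationSubringAtPrime_eq_valuationSubring]
  exact IsLocalization.AtPrime.isDiscreteValuationRing_of_dedekind_domain B w.ne_bot _

end Dedekind

section Integral

lemma mem_of_isIntegral {A L : Type*} [CommRing A] [Field L] [Algebra A L] {O : ValuationSubring L}
    (hA : ∀ a, algebraMap A L a ∈ O) {z : L} (hz : IsIntegral A z) : z ∈ O := by
  let f : A →+* O := (algebraMap A L).codRestrict O.toSubring hA
  obtain ⟨q, hq, h⟩ := hz
  have hz' : IsIntegral O z := ⟨q.map f, hq.map f, by rw [Polynomial.eval₂_map]; exact h⟩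
  obtain ⟨y, rfl⟩ := IsIntegrallyClosed.isIntegral_iff.1 hz'
  exact y.2

lemma comap_ne_top_of_ne_top {E L : Type*} [Field E] [Field L] [Algebra E L]
    [Algebra.IsAlgebraic E L] {O : ValuationSubring L} (hO : O ≠ ⊤) :
    O.comap (algebraMap E L) ≠ ⊤ := by
  intro h
  apply hO
  rw [eq_top_iff]
  intro z _
  refine mem_of_isIntegral (A := E) (fun a => ?_) (Algebra.IsAlgebraic.isAlgebraic z).isIntegral
  have : a ∈ O.comap (algebraMap E L) := h ▸ ValuationSubring.mem_top a
  exact this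

end Integral

/-! ### Extensions of a discrete valuation ring: number and ramification. -/

section Extension

variable {A E L : Type*} [CommRing A] [IsDomain A] [IsDiscreteValuationRing A] [Field E] [Field L]
  [Algebra A E] [IsFractionRing A E] [Algebra E L] {O : ValuationSubring L}

lemma ne_top_of_forall_mem_iff
    (hA : ∀ a : E, algebraMap E L a ∈ O ↔ a ∈ (algebraMap A E).range) : O ≠ ⊤ := by
  rintro rfl
  apply IsDiscreteValuationRing.not_isField A
  have hs : Function.Surjective (algebraMap A E) := fun a => (hA a).1 (ValuationSubring.mem_top _)
  exact MulEquiv.isField (Field.toIsField E)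
    (RingEquiv.ofBijective (algebraMap A E) ⟨IsFractionRing.injective A E, hs⟩).toMulEquiv

variable [Algebra A L] [IsScalarTower A E L]

/-- A place above a discrete valuation ring is given by a maximal ideal of its integral
closure. -/
theorem exists_heightOneSpectrum_integralClosure [IsDedekindDomain (integralClosure A L)]
    [IsFractionRing (integralClosure A L) L]
    (hA : ∀ a : E, algebraMap E L a ∈ O ↔ a ∈ (algebraMap A E).range) :
    ∃ w : HeightOneSpectrum (integralClosure A L), (w.valuation L).valuationSubring = O ∧
      w.asIdeal.LiesOver (IsLocalRing.maximalIdeal A) := by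
  obtain ⟨w, h1, -⟩ := exists_heightOneSpectrum_valuationSubring (B := integralClosure A L)
    (O := O) (fun b => mem_of_isIntegral (A := A)
      (fun a => by rw [IsScalarTower.algebraMap_apply A E L, hA]; exact ⟨a, rfl⟩) b.2)
    (ne_top_of_forall_mem_iff hA)
  refine ⟨w, h1, ⟨?_⟩⟩
  have := w.isMaximal
  exact (IsLocalRing.eq_maximalIdeal
    (Ideal.isMaximal_comap_of_isIntegral_of_isMaximal w.asIdeal)).symm

variable [FiniteDimensional E L] [Algebra.IsSeparable E L]

theorem isDiscreteValuationRing_of_forall_mem_iff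
    (hA : ∀ a : E, algebraMap E L a ∈ O ↔ a ∈ (algebraMap A E).range) :
    IsDiscreteValuationRing O := by
  have := integralClosure.isDedekindDomain A E L
  have := integralClosure.isFractionRing_of_finite_extension (A := A) E L
  obtain ⟨w, rfl, -⟩ := exists_heightOneSpectrum_integralClosure hA
  exact isDiscreteValuationRing_valuationSubring w

/-- A discrete valuation ring has at most `[L : E]` extensions to `L`. -/
theorem finite_and_ncard_le_finrank :
    {O : ValuationSubring L | ∀ a : E, algebraMap E L a ∈ O ↔ a ∈ (algebraMap A E).range}.Finite ∧
    {O : ValuationSubring L |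
      ∀ a : E, algebraMap E L a ∈ O ↔ a ∈ (algebraMap A E).range}.ncard ≤ Module.finrank E L := by
  have := integralClosure.isDedekindDomain A E L
  have := integralClosure.isFractionRing_of_finite_extension (A := A) E L
  have : Module.Finite A (integralClosure A L) :=
    IsIntegralClosure.finite A E L (integralClosure A L)
  have hfin := Algebra.QuasiFinite.finite_primesOver (S := integralClosure A L)
    (IsLocalRing.maximalIdeal A)
  have hcard : (Ideal.primesOver (IsLocalRing.maximalIdeal A) (integralClosure A L)).ncard ≤
      Module.finrank E L := by
    have := hfin.fintype
    have := Module.IsTorsionFree.trans_faithfulSMul A E L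
    -- The fundamental identity writes the degree as the sum of `e * f` over the primes; each term
    -- is at least `1`.
    rw [IsFractionRing.finrank_eq A E (integralClosure A L) L,
      ← Ideal.sum_ramification_inertia_eq_finrank (IsLocalRing.maximalIdeal A),
      ← Set.fintypeCard_eq_ncard, ← Finset.card_univ, Finset.card_eq_sum_ones]
    refine Finset.sum_le_sum fun P _ => ?_
    have := P.2.1
    exact Nat.mul_pos (P.1.ramificationIdx_pos A) (P.1.inertiaDeg_pos A)
  have hex (O : ValuationSubring L)
      (hO : ∀ a : E, algebraMap E L a ∈ O ↔ a ∈ (algebraMap A E).range) :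
      ∃ I : Ideal (integralClosure A L), ∃ w : HeightOneSpectrum (integralClosure A L),
        w.asIdeal = I ∧ (w.valuation L).valuationSubring = O ∧
        w.asIdeal.LiesOver (IsLocalRing.maximalIdeal A) := by
    obtain ⟨w, hw⟩ := exists_heightOneSpectrum_integralClosure hO
    exact ⟨_, w, rfl, hw⟩
  choose! f hf using hex
  have hmaps : Set.MapsTo f
      {O : ValuationSubring L | ∀ a : E, algebraMap E L a ∈ O ↔ a ∈ (algebraMap A E).range}
      (Ideal.primesOver (IsLocalRing.maximalIdeal A) (integralClosure A L)) := by
    intro O hO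
    obtain ⟨w, hw, -, hw'⟩ := hf O hO
    exact hw ▸ ⟨w.isPrime, hw'⟩
  have hinj : Set.InjOn f
      {O : ValuationSubring L | ∀ a : E, algebraMap E L a ∈ O ↔ a ∈ (algebraMap A E).range} := by
    intro O hO O' hO' h
    obtain ⟨w, hw, h1, -⟩ := hf O hO
    obtain ⟨w', hw', h1', -⟩ := hf O' hO'
    rw [← h1, ← h1', HeightOneSpectrum.ext (hw.trans (h.trans hw'.symm))]
  exact ⟨Set.Finite.of_injOn hmaps hinj hfin,
    (Set.ncard_le_ncard_of_injOn _ hmaps hinj hfin).trans hcard⟩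

theorem ramificationIdx'_dvd_finrank [IsGalois E L] [IsDedekindDomain (integralClosure A L)]
    (w : HeightOneSpectrum (integralClosure A L))
    [w.asIdeal.LiesOver (IsLocalRing.maximalIdeal A)] :
    (IsLocalRing.maximalIdeal A).ramificationIdx' w.asIdeal ∣ Module.finrank E L := by
  have := integralClosure.isFractionRing_of_finite_extension (A := A) E L
  have : Module.Finite A (integralClosure A L) :=
    IsIntegralClosure.finite A E L (integralClosure A L)
  let : MulSemiringAction Gal(L/E) (integralClosure A L) :=
    IsIntegralClosure.MulSemiringAction A E L (integralClosure A L)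
  have := IsGaloisGroup.of_isFractionRing Gal(L/E) A (integralClosure A L) E L
  have := Module.IsTorsionFree.trans_faithfulSMul A E L
  have h := Ideal.ncard_primesOver_mul_ramificationIdxIn_mul_inertiaDegIn
    (IsLocalRing.maximalIdeal A) (integralClosure A L) Gal(L/E)
  rw [Ideal.ramificationIdxIn_eq_ramificationIdx _ w.asIdeal Gal(L/E),
    IsGalois.card_aut_eq_finrank] at h
  rw [Ideal.ramificationIdx'_eq_ramificationIdx _ _ (IsDiscreteValuationRing.not_a_field A), ← h]
  exact Dvd.dvd.mul_left (dvd_mul_right _ _) _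

/-- Bridges the subgroup index and the ideal-theoretic index `e`. The valuation identifies `Lˣ / Oˣ`
with `ℤ`, and a uniformizer of `A` maps to a generator of `eℤ`, so the index divides `e`. In the
Galois case `e` divides the degree by `e * f * r = [L : E]`. -/
theorem ramificationIndex_dvd_finrank [IsGalois E L]
    (hA : ∀ a : E, algebraMap E L a ∈ O ↔ a ∈ (algebraMap A E).range) :
    ramificationIndex E O ∣ Module.finrank E L := by
  have := integralClosure.isDedekindDomain A E L
  have := integralClosure.isFractionRing_of_finite_extension (A := A) E L
  obtain ⟨w, rfl, hw⟩ := exists_heightOneSpectrum_integralClosure hA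
  let v : HeightOneSpectrum A :=
    ⟨IsLocalRing.maximalIdeal A, inferInstance, IsDiscreteValuationRing.not_a_field A⟩
  have : w.asIdeal.LiesOver v.asIdeal := hw
  have := Module.IsTorsionFree.trans_faithfulSMul A E L
  refine dvd_trans ?_ (ramificationIdx'_dvd_finrank (E := E) w)
  set e := (IsLocalRing.maximalIdeal A).ramificationIdx' w.asIdeal
  obtain ⟨t, ht⟩ := v.valuation_exists_uniformizer E
  have ht0 : t ≠ 0 := by
    rintro rfl
    rw [map_zero] at ht
    exact WithZero.exp_ne_zero ht.symm
  let χ : Lˣ →* Multiplicative ℤ :=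
    (WithZero.unitsWithZeroEquiv : _ ≃* Multiplicative ℤ).toMonoidHom.comp
      (Units.map (w.valuation L : L →* WithZero (Multiplicative ℤ)))
  have hχ (z : Lˣ) : ((χ z : Multiplicative ℤ) : WithZero (Multiplicative ℤ)) =
      w.valuation L z := by
    simp [χ]
  have hsurj : Function.Surjective χ := by
    intro z
    obtain ⟨y, hy⟩ := w.valuation_surjective L (z : WithZero (Multiplicative ℤ))
    have hy0 : y ≠ 0 := by
      rintro rfl
      rw [map_zero] at hy
      exact WithZero.coe_ne_zero hy.symm
    exact ⟨Units.mk0 y hy0, WithZero.coe_inj.1 ((hχ _).trans hy)⟩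
  have hker : χ.ker = (w.valuation L).valuationSubring.unitGroup := by
    ext z
    rw [MonoidHom.mem_ker, ValuationSubring.mem_unitGroup_iff,
      ← (w.valuation L).isEquiv_valuation_valuationSubring.eq_one_iff_eq_one, ← hχ,
      ← WithZero.coe_one, WithZero.coe_inj]
  rw [ramificationIndex, ← hker, ← Subgroup.index_map_eq _ hsurj le_sup_right, Subgroup.map_sup]
  have hmem : Subgroup.zpowers (Multiplicative.ofAdd (-(e : ℤ))) ≤
      Subgroup.map χ (Units.map (algebraMap E L : E →* L)).range := by
    rw [Subgroup.zpowers_le]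
    refine ⟨_, ⟨Units.mk0 t ht0, rfl⟩, WithZero.coe_inj.1 ((hχ _).trans ?_)⟩
    change w.valuation L (algebraMap E L t) = _
    rw [← valuation_liesOver L v w, ht, ← WithZero.exp_nsmul]
    simp [WithZero.exp, e, v]
  refine (Subgroup.index_dvd_of_le (hmem.trans le_sup_left)).trans ?_
  rw [← Subgroup.index_toAddSubgroup]
  have h : (AddSubgroup.zmultiples (-(e : ℤ))).index = e := by
    rw [Int.index_zmultiples, Int.natAbs_neg, Int.natAbs_natCast]
  exact dvd_of_eq h

end Extension

/-! ### The valuation ring of power series. -/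

section SeriesRing

variable (Ω : Type*) [Field Ω]

/-- The valuation ring of power series in the field of Laurent series. -/
noncomputable def seriesRing : ValuationSubring (LaurentSeries Ω) :=
  (ValuationRing.valuation (PowerSeries Ω) (LaurentSeries Ω)).valuationSubring

variable {Ω}

lemma mem_seriesRing {z : LaurentSeries Ω} :
    z ∈ seriesRing Ω ↔ ∃ f, algebraMap (PowerSeries Ω) (LaurentSeries Ω) f = z :=
  ValuationRing.mem_integer_iff _ _ z

lemma algebraMap_mem_nonunits_seriesRing {f : PowerSeries Ω} :
    algebraMap (PowerSeries Ω) (LaurentSeries Ω) f ∈ (seriesRing Ω).nonunits ↔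
      PowerSeries.constantCoeff f = 0 := by
  have hinj := IsFractionRing.injective (PowerSeries Ω) (LaurentSeries Ω)
  rw [ValuationSubring.mem_nonunits_iff_or, mem_seriesRing,
    FaithfulSMul.algebraMap_eq_zero_iff, ← not_iff_not, not_or, not_not]
  constructor
  · rintro ⟨h0, g, hg⟩ h
    have h1 : g * f = 1 := by
      apply hinj
      rw [map_mul, hg, map_one, inv_mul_cancel₀]
      exact (map_ne_zero_iff _ hinj).2 h0
    have := congrArg PowerSeries.constantCoeff h1
    simp [h] at this
  · intro h
    obtain ⟨u, hu⟩ := (PowerSeries.isUnit_iff_constantCoeff.2 (isUnit_iff_ne_zero.2 h))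
    refine ⟨by rintro rfl; simp at h, ((u⁻¹ : (PowerSeries Ω)ˣ) : PowerSeries Ω), ?_⟩
    rw [← hu]
    refine eq_inv_of_mul_eq_one_left ?_
    rw [← map_mul, Units.inv_mul, map_one]

lemma order_eq_zero_of_mem_of_inv_mem {z : LaurentSeries Ω} (hz : z ∈ seriesRing Ω)
    (hz' : z⁻¹ ∈ seriesRing Ω) (h0 : z ≠ 0) : z.order = 0 := by
  obtain ⟨f, rfl⟩ := mem_seriesRing.1 hz
  obtain ⟨g, hg⟩ := mem_seriesRing.1 hz'
  refine order_algebraMap_of_isUnit (isUnit_iff_exists_inv.2 ⟨g, ?_⟩)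
  apply IsFractionRing.injective (PowerSeries Ω) (LaurentSeries Ω)
  rw [map_mul, hg, map_one, mul_inv_cancel₀ h0]

end SeriesRing

/-! ### Places of the rational function field and their extensions. -/

section RatFunc

variable {K : Type*} [Field K]

lemma exists_ratFunc_ringHom {M : Type*} [Field M] (f : K →+* M) (s : M)
    (hs : ∀ g : K[X], g ≠ 0 → g.eval₂ f s ≠ 0) :
    ∃ ψ : RatFunc K →+* M, (∀ g : K[X], ψ (algebraMap K[X] (RatFunc K) g) = g.eval₂ f s) := by
  have h : nonZeroDivisors K[X] ≤ (nonZeroDivisors M).comap (eval₂RingHom f s) := fun g hg => by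
    rw [Submonoid.mem_comap, coe_eval₂RingHom]
    exact mem_nonZeroDivisors_of_ne_zero (hs g (nonZeroDivisors.ne_zero hg))
  exact ⟨RatFunc.liftRingHom (eval₂RingHom f s) h, fun g => RatFunc.liftRingHom_algebraMap _ h g⟩

lemma exists_ratFunc_algEquiv_inv :
    ∃ σ : RatFunc K ≃ₐ[K] RatFunc K, σ RatFunc.X = RatFunc.X⁻¹ := by
  have h : Transcendental K (RatFunc.X⁻¹ : RatFunc K) := by
    intro h
    exact RatFunc.transcendental_X (K := K) (by simpa using h.inv)
  have htop : IntermediateField.adjoin K {(RatFunc.X⁻¹ : RatFunc K)} = ⊤ := by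
    rw [eq_top_iff, ← RatFunc.adjoin_X, IntermediateField.adjoin_simple_le_iff]
    simpa using inv_mem (IntermediateField.mem_adjoin_simple_self K (RatFunc.X⁻¹ : RatFunc K))
  exact ⟨(RatFunc.algEquivOfTranscendental _ h).trans
    ((IntermediateField.equivOfEq htop).trans IntermediateField.topEquiv), by simp⟩

lemma algebraMap_mem_of_X_mem {P : ValuationSubring (RatFunc K)}
    (hK : ∀ a : K, algebraMap K (RatFunc K) a ∈ P) (hX : RatFunc.X ∈ P) (f : K[X]) :
    algebraMap K[X] (RatFunc K) f ∈ P := by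
  induction f using Polynomial.induction_on' with
  | add f g hf hg => rw [map_add]; exact P.add_mem _ _ hf hg
  | monomial k a =>
    rw [← C_mul_X_pow_eq_monomial, map_mul, map_pow, RatFunc.algebraMap_X, RatFunc.algebraMap_C]
    exact P.mul_mem _ _ (hK a) (pow_mem hX k)

lemma isDiscreteValuationRing_of_X_mem {P : ValuationSubring (RatFunc K)}
    (hP : P ∈ places K (RatFunc K)) (hX : RatFunc.X ∈ P) : IsDiscreteValuationRing P := by
  obtain ⟨w, rfl, -⟩ := exists_heightOneSpectrum_valuationSubring (B := K[X]) (O := P)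
    (algebraMap_mem_of_X_mem hP.2 hX) hP.1
  exact isDiscreteValuationRing_valuationSubring w

/-- Either `X` or its inverse lies in the place. The first case is a localization of `K[X]`, and the
automorphism inverting `X` reduces the second to it. -/
theorem isDiscreteValuationRing_of_mem_places {P : ValuationSubring (RatFunc K)}
    (hP : P ∈ places K (RatFunc K)) : IsDiscreteValuationRing P := by
  rcases P.mem_or_inv_mem RatFunc.X with hX | hX
  · exact isDiscreteValuationRing_of_X_mem hP hX
  obtain ⟨σ, hσ⟩ := exists_ratFunc_algEquiv_inv (K := K)
  let P' := P.comap (σ : RatFunc K →+* RatFunc K)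
  have hmem (z) : z ∈ P' ↔ σ z ∈ P := Iff.rfl
  have : IsDiscreteValuationRing P' := by
    refine isDiscreteValuationRing_of_X_mem ⟨fun h => hP.1 ?_, fun a => ?_⟩ ?_
    · rw [eq_top_iff]
      intro z _
      have := (hmem (σ.symm z)).1 (h ▸ ValuationSubring.mem_top _)
      simpa using this
    · rw [hmem, AlgEquiv.commutes]; exact hP.2 a
    · rwa [hmem, hσ]
  let e : P' ≃+* P := RingEquiv.ofBijective
    (((σ : RatFunc K →+* RatFunc K).comp P'.subtype).codRestrict P.toSubring fun z => z.2)
    ⟨fun a b h => Subtype.ext (σ.injective (congrArg Subtype.val h)), fun z =>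
      ⟨⟨σ.symm z, by rw [hmem]; simp⟩, Subtype.ext (σ.apply_symm_apply _)⟩⟩
  exact IsDiscreteValuationRing.RingEquivClass.isDiscreteValuationRing e

end RatFunc

section Above

variable {E L : Type*} [Field E] [Field L] [Algebra E L]

/-- Chevalley's extension theorem gives a valuation ring of `L` dominating `P`. An element of `E` in
`O` but not in `P` would have its inverse in `P`, a unit in `O` but not in `P`, contrary to
domination. -/
theorem exists_comap_eq (P : ValuationSubring E) :
    ∃ O : ValuationSubring L, O.comap (algebraMap E L) = P := by
  obtain ⟨O, h, hloc⟩ := IsLocalRing.exists_factor_valuationRing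
    ((algebraMap E L).comp P.subtype)
  refine ⟨O, ValuationSubring.ext _ _ fun z => ⟨fun hz => ?_, fun hz => h ⟨z, hz⟩⟩⟩
  by_contra hzP
  have hz' := (P.mem_or_inv_mem z).resolve_left hzP
  have hz0 : z ≠ 0 := by rintro rfl; exact hzP P.zero_mem
  have hu : IsUnit (((algebraMap E L).comp P.subtype).codRestrict O.toSubring h ⟨z⁻¹, hz'⟩) := by
    refine isUnit_iff_exists_inv.2 ⟨⟨algebraMap E L z, hz⟩, Subtype.ext ?_⟩
    change algebraMap E L z⁻¹ * algebraMap E L z = 1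
    rw [← map_mul, inv_mul_cancel₀ hz0, map_one]
  obtain ⟨w, hw⟩ := isUnit_iff_exists_inv.1 (isUnit_of_map_unit _ _ hu)
  apply hzP
  have : z⁻¹ * (w : E) = 1 := congrArg Subtype.val hw
  rw [inv_mul_eq_one₀ hz0] at this
  exact this ▸ w.2

end Above

/-! ### Multiplicativity of the ramification index, and tameness in Kummer steps. -/

section Tame

lemma mem_unitGroup_iff_mem {L : Type*} [Field L] (O : ValuationSubring L) (z : Lˣ) :
    z ∈ O.unitGroup ↔ (z : L) ∈ O ∧ (z : L)⁻¹ ∈ O := by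
  rw [ValuationSubring.mem_unitGroup_iff, ← ValuationSubring.valuation_le_one_iff,
    ← ValuationSubring.valuation_le_one_iff, map_inv₀, inv_le_one₀, ← le_antisymm_iff]
  exact (Valuation.pos_iff _).2 z.ne_zero

variable {E F L : Type*} [Field E] [Field F] [Field L] [Algebra E F] [Algebra F L] [Algebra E L]
  [IsScalarTower E F L]

/-- In `Lˣ` the chain `Eˣ Oˣ ≤ Fˣ Oˣ ≤ Lˣ` splits the index in two. The lower factor is computed
inside `Fˣ`, where `Eˣ Oˣ` pulls back to `Eˣ` times the units of the restricted place. -/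
theorem ramificationIndex_mul (O : ValuationSubring L) :
    ramificationIndex E (O.comap (algebraMap F L)) * ramificationIndex F O =
      ramificationIndex E O := by
  set H₁ := (Units.map (algebraMap E L : E →* L)).range ⊔ O.unitGroup
  set H₂ := (Units.map (algebraMap F L : F →* L)).range ⊔ O.unitGroup
  have hle : (Units.map (algebraMap E L : E →* L)).range ≤
      (Units.map (algebraMap F L : F →* L)).range := by
    rintro _ ⟨e, rfl⟩
    refine ⟨Units.map (algebraMap E F : E →* F) e, Units.ext ?_⟩
    exact (IsScalarTower.algebraMap_apply E F L e).symm
  have h12 : H₁ ≤ H₂ := sup_le_sup_right hle _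
  have hH₂ : H₂ = (Units.map (algebraMap F L : F →* L)).range ⊔ H₁ := by
    rw [← sup_assoc, sup_of_le_left hle]
  have hunit (z : Fˣ) : Units.map (algebraMap F L : F →* L) z ∈ O.unitGroup ↔
      z ∈ (O.comap (algebraMap F L)).unitGroup := by
    rw [mem_unitGroup_iff_mem, mem_unitGroup_iff_mem, ValuationSubring.mem_comap,
      ValuationSubring.mem_comap, map_inv₀]
    rfl
  have hcomap : H₁.comap (Units.map (algebraMap F L : F →* L)) =
      (Units.map (algebraMap E F : E →* F)).range ⊔ (O.comap (algebraMap F L)).unitGroup := by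
    ext z
    rw [Subgroup.mem_comap, Subgroup.mem_sup, Subgroup.mem_sup]
    constructor
    · rintro ⟨_, ⟨e, rfl⟩, o, ho, h⟩
      refine ⟨_, ⟨e, rfl⟩, (Units.map (algebraMap E F : E →* F) e)⁻¹ * z, ?_, by simp⟩
      rw [← hunit, map_mul, ← h, map_inv]
      convert ho using 1
      ext
      simp [← IsScalarTower.algebraMap_apply]
    · rintro ⟨_, ⟨e, rfl⟩, o, ho, rfl⟩
      refine ⟨_, ⟨e, rfl⟩, _, (hunit o).2 ho, ?_⟩
      ext
      simp [← IsScalarTower.algebraMap_apply]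
  rw [ramificationIndex, ramificationIndex, ramificationIndex, ← Subgroup.relIndex_mul_index h12,
    ← hcomap, Subgroup.index_comap]
  congr 1
  rw [hH₂, Subgroup.relIndex_sup_right]

/-- Discreteness travels with tameness because bounding ramification in the next step requires a
discrete place below. -/
theorem isDiscreteValuationRing_and_not_dvd_ramificationIndex [FiniteDimensional F L] [IsGalois F L]
    {p : ℕ} (hp : p.Prime) (hpm : ¬ p ∣ Module.finrank F L) {O : ValuationSubring L}
    (hdvr : IsDiscreteValuationRing (O.comap (algebraMap F L)))
    (hram : ¬ p ∣ ramificationIndex E (O.comap (algebraMap F L))) :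
    IsDiscreteValuationRing O ∧ ¬ p ∣ ramificationIndex E O := by
  let : Algebra (O.comap (algebraMap F L)) L :=
    ((algebraMap F L).comp (algebraMap (O.comap (algebraMap F L)) F)).toAlgebra
  have : IsScalarTower (O.comap (algebraMap F L)) F L := IsScalarTower.of_algebraMap_eq' rfl
  have hA (a : F) : algebraMap F L a ∈ O ↔ a ∈ (algebraMap (O.comap (algebraMap F L)) F).range :=
    ⟨fun h => ⟨⟨a, h⟩, rfl⟩, by rintro ⟨b, rfl⟩; exact b.2⟩
  refine ⟨isDiscreteValuationRing_of_forall_mem_iff hA, fun h => ?_⟩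
  rw [← ramificationIndex_mul (F := F), hp.dvd_mul] at h
  exact h.elim hram fun h => hpm (h.trans (ramificationIndex_dvd_finrank hA))

end Tame

section TowerTame

variable {K E C : Type*} [Field K] [Field E] [Field C] [Algebra K E] [Algebra E C] [Algebra K C]
  [IsScalarTower K E C]

lemma isGalois_adjoin_root (F : IntermediateField E C) {y : C} {m : ℕ} (hm : 0 < m)
    (hy : y ^ m ∈ F) (hdeg : (minpoly F y).natDegree = m) {ζ : F} (hζ : IsPrimitiveRoot ζ m) :
    IsGalois F (IntermediateField.adjoin F {y}) := by
  have hint := isIntegral_of_pow_mem F hm hy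
  have hfin := IntermediateField.adjoin.finrank hint
  rw [hdeg] at hfin
  have := IntermediateField.adjoin.finiteDimensional hint
  have hroots : (primitiveRoots (Module.finrank F (IntermediateField.adjoin F {y})) F).Nonempty :=
    ⟨ζ, by rw [hfin]; exact (mem_primitiveRoots hm).2 hζ⟩
  have ha : (IntermediateField.AdjoinSimple.gen F y) ^
      (Module.finrank F (IntermediateField.adjoin F {y})) =
      algebraMap F (IntermediateField.adjoin F {y}) ⟨y ^ m, hy⟩ := by
    rw [hfin]; ext; rfl
  have htop : IntermediateField.adjoin F {IntermediateField.AdjoinSimple.gen F y} = ⊤ := by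
    apply IntermediateField.lift_injective
    rw [IntermediateField.lift_adjoin_simple, IntermediateField.lift_top]
    rfl
  have := isSplittingField_X_pow_sub_C_of_root_adjoin_eq_top hroots ha htop
  exact isGalois_of_isSplittingField_X_pow_sub_C hroots
    (irreducible_X_pow_sub_C_of_root_adjoin_eq_top ha htop) _

/-- Every place of `F` is a discrete valuation ring with ramification index prime to `p`. -/
def HasTamePlaces (K : Type*) {E C : Type*} [Field K] [Field E] [Field C] [Algebra K E]
    [Algebra E C] [Algebra K C] [IsScalarTower K E C] (p : ℕ) (F : IntermediateField E C) : Prop :=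
  ∀ O ∈ places K F, IsDiscreteValuationRing O ∧ ¬ p ∣ ramificationIndex E O

lemma hasTamePlaces_bot {p : ℕ} (hp : p.Prime)
    (hE : ∀ P ∈ places K E, IsDiscreteValuationRing P) :
    HasTamePlaces K p (⊥ : IntermediateField E C) := by
  intro O hO
  have hone (P : ValuationSubring E) : ramificationIndex E P = 1 := by
    rw [ramificationIndex, Subgroup.index_eq_one, eq_top_iff]
    exact le_sup_of_le_left fun z _ => ⟨z, rfl⟩
  refine isDiscreteValuationRing_and_not_dvd_ramificationIndex (F := E) hp ?_
    (hE _ ⟨comap_ne_top_of_ne_top hO.1, fun a => ?_⟩) ?_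
  · rw [IntermediateField.finrank_bot]; exact hp.one_lt.ne' ∘ Nat.dvd_one.1
  · rw [ValuationSubring.mem_comap, ← IsScalarTower.algebraMap_apply]; exact hO.2 a
  · rw [hone]; exact hp.one_lt.ne' ∘ Nat.dvd_one.1

lemma hasTamePlaces_sup_adjoin {p : ℕ} (hp : p.Prime) {F : IntermediateField E C}
    (hF : HasTamePlaces K p F) {y : C} {m : ℕ} (hm : 0 < m) (hpm : ¬ p ∣ m) (hy : y ^ m ∈ F)
    (hdeg : (minpoly F y).natDegree = m) {ζ : F} (hζ : IsPrimitiveRoot ζ m) :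
    HasTamePlaces K p (F ⊔ IntermediateField.adjoin E {y}) := by
  have hint := isIntegral_of_pow_mem F hm hy
  have := IntermediateField.adjoin.finiteDimensional hint
  have := isGalois_adjoin_root F hm hy hdeg hζ
  rw [← IntermediateField.restrictScalars_adjoin_eq_sup]
  have : IsScalarTower K F C := IsScalarTower.of_algebraMap_eq fun _ => rfl
  suffices key : ∀ O ∈ places K (IntermediateField.adjoin F {y}),
      IsDiscreteValuationRing O ∧ ¬ p ∣ ramificationIndex E O from key
  intro O hO
  have hP : O.comap (algebraMap F (IntermediateField.adjoin F {y})) ∈ places K F :=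
    ⟨comap_ne_top_of_ne_top hO.1, fun a => hO.2 a⟩
  obtain ⟨h1, h2⟩ := hF _ hP
  exact isDiscreteValuationRing_and_not_dvd_ramificationIndex hp
    (by rwa [IntermediateField.adjoin.finrank hint, hdeg]) h1 h2

lemma isSeparable_sup_adjoin {F : IntermediateField E C} (hF : Algebra.IsSeparable E F)
    {y : C} {m : ℕ} (hm : 0 < m) (hy : y ^ m ∈ F)
    (hdeg : (minpoly F y).natDegree = m) {ζ : F} (hζ : IsPrimitiveRoot ζ m) :
    Algebra.IsSeparable E ↥(F ⊔ IntermediateField.adjoin E {y}) := by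
  have := isGalois_adjoin_root F hm hy hdeg hζ
  rw [← IntermediateField.restrictScalars_adjoin_eq_sup]
  exact Algebra.IsSeparable.trans E F (IntermediateField.adjoin F {y})

end TowerTame

/-! ### Substitution of power series in rational functions. -/

section SeriesHoms

variable {K Ω : Type*} [Field K] [Field Ω]

/-- The embedding of constants in the field of Laurent series. -/
noncomputable def constSeries (Ω : Type*) [Field Ω] : Ω →+* LaurentSeries Ω :=
  (algebraMap (PowerSeries Ω) (LaurentSeries Ω)).comp PowerSeries.C

lemma constSeries_mem (a : Ω) : constSeries Ω a ∈ seriesRing Ω :=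
  mem_seriesRing.2 ⟨PowerSeries.C a, rfl⟩

/-- Write `g = (X - a) ^ k * q` with `a` the constant term of `b` and `q(a) ≠ 0`. Then `b - a` has a
linear term and `q(b)` has constant term `q(a)`. -/
lemma eval₂_powerSeries_ne_zero {b : PowerSeries Ω} (hb : PowerSeries.coeff 1 b ≠ 0) {g : Polynomial Ω}
    (hg : g ≠ 0) : g.eval₂ PowerSeries.C b ≠ 0 := by
  set a := PowerSeries.constantCoeff b
  obtain ⟨q, hq, hq'⟩ := exists_eq_pow_rootMultiplicity_mul_and_not_dvd g hg a
  rw [hq, eval₂_mul, eval₂_pow, eval₂_sub, eval₂_X, eval₂_C]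
  refine mul_ne_zero (pow_ne_zero _ fun h => hb ?_) fun h => hq' ?_
  · simpa [PowerSeries.coeff_C] using congrArg (PowerSeries.coeff 1) h
  · rw [dvd_iff_isRoot, IsRoot]
    have := congrArg PowerSeries.constantCoeff h
    rwa [hom_eval₂, map_zero, PowerSeries.constantCoeff_comp_C, eval₂_id] at this

/-- The substitution of a power series with nonvanishing linear coefficient in rational
functions. -/
lemma exists_ratFunc_hom_series (f : K →+* Ω) {b : PowerSeries Ω}
    (hb : PowerSeries.coeff 1 b ≠ 0) : ∃ ψ : RatFunc K →+* LaurentSeries Ω,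
      (∀ a : K, ψ (algebraMap K (RatFunc K) a) = constSeries Ω (f a)) ∧
      ψ RatFunc.X = algebraMap (PowerSeries Ω) (LaurentSeries Ω) b := by
  obtain ⟨ψ, hψ⟩ := exists_ratFunc_ringHom ((constSeries Ω).comp f)
    (algebraMap (PowerSeries Ω) (LaurentSeries Ω) b) (by
      intro g hg
      have h := eval₂_powerSeries_ne_zero hb (map_ne_zero_iff (mapRingHom f) (map_injective f f.injective) |>.2 hg)
      rw [coe_mapRingHom, eval₂_map] at h
      rw [constSeries, RingHom.comp_assoc, ← hom_eval₂]
      exact (map_ne_zero_iff _ (IsFractionRing.injective _ _)).2 h)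
  refine ⟨ψ, fun a => ?_, ?_⟩
  · rw [RatFunc.algebraMap_eq_C, ← RatFunc.algebraMap_C, hψ, eval₂_C]; rfl
  · rw [← RatFunc.algebraMap_X, hψ, eval₂_X]

end SeriesHoms

/-! ### Rational places as Laurent expansions. -/

section RationalPlaces

variable {K : Type*} [Field K]

lemma mul_mem_nonunits {L : Type*} [Field L] {O : ValuationSubring L} {y z : L} (hy : y ∈ O)
    (hz : z ∈ O.nonunits) : y * z ∈ O.nonunits := by
  rw [ValuationSubring.mem_nonunits_iff] at hz ⊢
  rw [map_mul]
  exact (mul_le_of_le_one_left' ((O.valuation_le_one_iff y).2 hy)).trans_lt hz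

lemma one_notMem_nonunits {L : Type*} [Field L] (O : ValuationSubring L) :
    (1 : L) ∉ O.nonunits := by
  rw [ValuationSubring.mem_nonunits_iff, map_one]; exact lt_irrefl _

lemma inv_mem_of_notMem_nonunits {L : Type*} [Field L] {O : ValuationSubring L} {z : L}
    (hz : z ∉ O.nonunits) : z⁻¹ ∈ O := by
  rw [ValuationSubring.mem_nonunits_iff_or, not_or, not_not] at hz
  exact hz.2

lemma inv_mem_nonunits_of_notMem {L : Type*} [Field L] {O : ValuationSubring L} {z : L}
    (hz : z ∉ O) : z⁻¹ ∈ O.nonunits :=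
  O.inv_mem_nonunits_iff.2 (Or.inr hz)

lemma mem_nonunits_comap {L M : Type*} [Field L] [Field M] (V : ValuationSubring M) (φ : L →+* M)
    (z : L) : z ∈ (V.comap φ).nonunits ↔ φ z ∈ V.nonunits := by
  rw [ValuationSubring.mem_nonunits_iff_or, ValuationSubring.mem_nonunits_iff_or,
    ValuationSubring.mem_comap, map_inv₀, map_eq_zero]

/-- A place with `X ≡ a` reduces every polynomial to its value at `a`. For `z` in `P` in lowest
terms, the denominator cannot vanish at `a`, for then both coprime parts would be nonunits; so it is
a unit at `P'` as well. -/
lemma le_of_X_sub_mem_nonunits {P P' : ValuationSubring (RatFunc K)}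
    (hK : ∀ a : K, algebraMap K (RatFunc K) a ∈ P) (hK' : ∀ a : K, algebraMap K (RatFunc K) a ∈ P')
    {a : K} (ha : RatFunc.X - algebraMap K (RatFunc K) a ∈ P.nonunits)
    (ha' : RatFunc.X - algebraMap K (RatFunc K) a ∈ P'.nonunits) : P ≤ P' := by
  have key {R : ValuationSubring (RatFunc K)} (hR : ∀ a : K, algebraMap K (RatFunc K) a ∈ R)
      (hRa : RatFunc.X - algebraMap K (RatFunc K) a ∈ R.nonunits) :
      (∀ f : K[X], algebraMap K[X] (RatFunc K) f ∈ R) ∧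
      ∀ f : K[X], algebraMap K[X] (RatFunc K) f - algebraMap K (RatFunc K) (f.eval a) ∈
        R.nonunits := by
    have hmem := algebraMap_mem_of_X_mem hR (by
      simpa using R.add_mem _ _ (R.nonunits_subset hRa) (hR a))
    refine ⟨hmem, fun f => ?_⟩
    obtain ⟨q, hq⟩ := X_sub_C_dvd_sub_C_eval (a := a) (p := f)
    rw [RatFunc.algebraMap_eq_C, ← RatFunc.algebraMap_C, ← map_sub, hq, map_mul, mul_comm, map_sub, RatFunc.algebraMap_X,
      RatFunc.algebraMap_C, ← RatFunc.algebraMap_eq_C]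
    exact mul_mem_nonunits (hmem q) hRa
  obtain ⟨h1, h2⟩ := key hK ha
  obtain ⟨h1', h2'⟩ := key hK' ha'
  intro z hz
  have hd0 : algebraMap K[X] (RatFunc K) z.denom ≠ 0 :=
    (map_ne_zero_iff _ (RatFunc.algebraMap_injective K)).2 z.denom_ne_zero
  have hz' : z * algebraMap K[X] (RatFunc K) z.denom = algebraMap K[X] (RatFunc K) z.num := by
    exact (div_eq_iff hd0).1 z.num_div_denom |>.symm
  by_cases h0 : z.denom.eval a = 0
  · exfalso
    have hd := h2 z.denom
    rw [h0, map_zero, sub_zero] at hd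
    have hn := mul_mem_nonunits hz hd
    rw [hz'] at hn
    obtain ⟨u, v, huv⟩ := z.isCoprime_num_denom
    apply one_notMem_nonunits P
    rw [← map_one (algebraMap K[X] (RatFunc K)), ← huv, map_add, map_mul, map_mul]
    exact add_mem (mul_mem_nonunits (h1 u) hn) (mul_mem_nonunits (h1 v) hd)
  · rw [(eq_mul_inv_iff_mul_eq₀ hd0).2 hz']
    refine P'.mul_mem _ _ (h1' _) (inv_mem_of_notMem_nonunits fun hd => ?_)
    have h3 := sub_mem hd (h2' z.denom)
    rw [sub_sub_cancel] at h3
    have h4 := mul_mem_nonunits (hK' (z.denom.eval a)⁻¹) h3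
    rw [← map_mul, inv_mul_cancel₀ h0, map_one] at h4
    exact one_notMem_nonunits P' h4

/-- A homomorphism from rational functions to Laurent series that is the identity on constants
and has dense image. -/
structure IsExpansion (ψ : RatFunc K →+* LaurentSeries K) : Prop where
  map_const : ∀ a : K, ψ (algebraMap K (RatFunc K) a) = constSeries K a
  exists_map_eq_X : ∃ t, ψ t = algebraMap (PowerSeries K) (LaurentSeries K) PowerSeries.X

lemma exists_isExpansion (a : K) : ∃ ψ : RatFunc K →+* LaurentSeries K, IsExpansion ψ ∧
    ψ RatFunc.X - constSeries K a ∈ (seriesRing K).nonunits := by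
  obtain ⟨ψ, h1, h2⟩ := exists_ratFunc_hom_series (RingHom.id K)
    (b := PowerSeries.C a + PowerSeries.X) (by simp)
  have h3 : ψ RatFunc.X - constSeries K a =
      algebraMap (PowerSeries K) (LaurentSeries K) PowerSeries.X := by
    rw [h2, map_add, constSeries, RingHom.comp_apply, add_sub_cancel_left]
  refine ⟨ψ, ⟨h1, RatFunc.X - algebraMap K (RatFunc K) a, ?_⟩, ?_⟩
  · rw [map_sub, h1, RingHom.id_apply, h3]
  · rw [h3, algebraMap_mem_nonunits_seriesRing, PowerSeries.constantCoeff_X]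

/-- Every rational place of the rational function field is given by an expansion in a Laurent
series. -/
theorem exists_isExpansion_comap_eq {P : ValuationSubring (RatFunc K)}
    (hP : P ∈ rationalPlaces K (RatFunc K)) : ∃ ψ : RatFunc K →+* LaurentSeries K,
      IsExpansion ψ ∧ (seriesRing K).comap ψ = P := by
  have key {P : ValuationSubring (RatFunc K)} (hK : ∀ a : K, algebraMap K (RatFunc K) a ∈ P)
      {a : K} (ha : RatFunc.X - algebraMap K (RatFunc K) a ∈ P.nonunits) :
      ∃ ψ : RatFunc K →+* LaurentSeries K, IsExpansion ψ ∧ (seriesRing K).comap ψ = P := by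
    obtain ⟨ψ, h1, h2⟩ := exists_isExpansion a
    have hK' (a : K) : algebraMap K (RatFunc K) a ∈ (seriesRing K).comap ψ := by
      rw [ValuationSubring.mem_comap, h1.map_const]; exact constSeries_mem a
    have ha' : RatFunc.X - algebraMap K (RatFunc K) a ∈ ((seriesRing K).comap ψ).nonunits := by
      rw [mem_nonunits_comap, map_sub, h1.map_const]; exact h2
    exact ⟨ψ, h1, le_antisymm (le_of_X_sub_mem_nonunits hK' hK ha' ha)
      (le_of_X_sub_mem_nonunits hK hK' ha ha')⟩
  by_cases hX : RatFunc.X ∈ P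
  · obtain ⟨a, ha⟩ := hP.2 _ hX
    exact key hP.1.2 ha
  -- The pole of `X`: inverting `X` turns it into the zero of `X`.
  · obtain ⟨σ, hσ⟩ := exists_ratFunc_algEquiv_inv (K := K)
    obtain ⟨ψ, h1, h2⟩ := key (P := P.comap (σ : RatFunc K →+* RatFunc K)) (a := 0)
      (fun a => by
        rw [ValuationSubring.mem_comap]
        exact (σ.commutes a).symm ▸ hP.1.2 a)
      (by
        rw [map_zero, sub_zero, mem_nonunits_comap]
        exact hσ.symm ▸ inv_mem_nonunits_of_notMem hX)
    obtain ⟨t, ht⟩ := h1.exists_map_eq_X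
    refine ⟨ψ.comp (σ.symm : RatFunc K →+* RatFunc K), ⟨fun a => ?_, σ t, ?_⟩, ?_⟩
    · exact (congrArg ψ (σ.symm.commutes a)).trans (h1.map_const a)
    · exact (congrArg ψ (σ.symm_apply_apply t)).trans ht
    · ext z
      have := congrArg (σ.symm z ∈ ·) h2
      simpa [ValuationSubring.mem_comap] using this

/-- An extension of an expansion is determined by the place it defines. -/
theorem IsExpansion.eq_of_comap_eq {ψ : RatFunc K →+* LaurentSeries K} (hψ : IsExpansion ψ)
    {L : Type*} [Field L] [Algebra (RatFunc K) L] {φ₁ φ₂ : L →+* LaurentSeries K}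
    (h₁ : φ₁.comp (algebraMap _ L) = ψ) (h₂ : φ₂.comp (algebraMap _ L) = ψ)
    (h : (seriesRing K).comap φ₁ = (seriesRing K).comap φ₂) : φ₁ = φ₂ := by
  obtain ⟨t, ht⟩ := hψ.exists_map_eq_X
  have hinj := IsFractionRing.injective (PowerSeries K) (LaurentSeries K)
  have ht0 : algebraMap (PowerSeries K) (LaurentSeries K) PowerSeries.X ≠ 0 :=
    (map_ne_zero_iff _ hinj).2 PowerSeries.X_ne_zero
  have ht₁ : φ₁ (algebraMap _ L t) = algebraMap _ _ PowerSeries.X := (congr($h₁ t)).trans ht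
  have ht₂ : φ₂ (algebraMap _ L t) = algebraMap _ _ PowerSeries.X := (congr($h₂ t)).trans ht
  -- The place determines the residue, that is, the constant coefficient. Since the constants and
  -- `t` come from `K(x)`, where both maps agree, subtracting the residue and dividing by `t`
  -- exposes the next coefficient.
  have key (N : ℕ) : ∀ (z : L) (f₁ f₂ : PowerSeries K), φ₁ z = algebraMap _ _ f₁ → φ₂ z = algebraMap _ _ f₂ →
      PowerSeries.X ^ N ∣ f₁ - f₂ := by
    induction N with
    | zero => simp
    | succ N ih =>
      intro z f₁ f₂ hf₁ hf₂
      set a := PowerSeries.constantCoeff f₁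
      set c := algebraMap (RatFunc K) L (algebraMap K (RatFunc K) a)
      have hc₁ : φ₁ c = algebraMap _ _ (PowerSeries.C a) := (congr($h₁ _)).trans (hψ.map_const a)
      have hc₂ : φ₂ c = algebraMap _ _ (PowerSeries.C a) := (congr($h₂ _)).trans (hψ.map_const a)
      have hz₁ : φ₁ (z - c) = algebraMap _ _ (f₁ - PowerSeries.C a) := by
        rw [map_sub, map_sub, hf₁, hc₁]
      have hz₂ : φ₂ (z - c) = algebraMap _ _ (f₂ - PowerSeries.C a) := by
        rw [map_sub, map_sub, hf₂, hc₂]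
      have ha₁ : PowerSeries.constantCoeff (f₁ - PowerSeries.C a) = 0 := by simp [a]
      have ha₂ : PowerSeries.constantCoeff (f₂ - PowerSeries.C a) = 0 := by
        rw [← algebraMap_mem_nonunits_seriesRing, ← hz₂, ← mem_nonunits_comap, ← h,
          mem_nonunits_comap, hz₁, algebraMap_mem_nonunits_seriesRing, ha₁]
      obtain ⟨g₁, hg₁⟩ := PowerSeries.X_dvd_iff.2 ha₁
      obtain ⟨g₂, hg₂⟩ := PowerSeries.X_dvd_iff.2 ha₂
      have := ih ((z - c) / algebraMap _ L t) g₁ g₂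
        (by rw [map_div₀, ht₁, hz₁, hg₁, map_mul, mul_div_cancel_left₀ _ ht0])
        (by rw [map_div₀, ht₂, hz₂, hg₂, map_mul, mul_div_cancel_left₀ _ ht0])
      have hsub : f₁ - f₂ = PowerSeries.X * (g₁ - g₂) := by
        rw [mul_sub, ← hg₁, ← hg₂]; ring
      rw [hsub, pow_succ']
      exact mul_dvd_mul_left _ this
  have hmem (z : L) (hz : φ₁ z ∈ seriesRing K) : φ₁ z = φ₂ z := by
    have hz' : φ₂ z ∈ seriesRing K := by
      rwa [← ValuationSubring.mem_comap, ← h, ValuationSubring.mem_comap]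
    obtain ⟨f₁, hf₁⟩ := mem_seriesRing.1 hz
    obtain ⟨f₂, hf₂⟩ := mem_seriesRing.1 hz'
    rw [← hf₁, ← hf₂]
    congr 1
    ext n
    rw [← sub_eq_zero, ← map_sub]
    exact PowerSeries.X_pow_dvd_iff.1 (key (n + 1) z f₁ f₂ hf₁.symm hf₂.symm) n n.lt_succ_self
  ext1 z
  rcases (seriesRing K).mem_or_inv_mem (φ₁ z) with hz | hz
  · exact hmem z hz
  · rw [← map_inv₀] at hz
    simpa using hmem _ hz

end RationalPlaces

/-! ### Solving the tower equation in Laurent series over the finite field. -/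

section Lifts

variable {K : Type*} [Field K] [Finite K] {p Q m : ℕ}

/-- Over a finite field with `Q` elements the right hand side of the tower equation, evaluated at
any Laurent series, is a power series with constant coefficient `1`. -/
lemma towerDen_ne_zero_and_exists_div_eq (hp : 2 ≤ p) (hQ : Nat.card K = Q) (s : LaurentSeries K) :
    towerDen p Q s ≠ 0 ∧ ∃ w : PowerSeries K, PowerSeries.constantCoeff w = 1 ∧
      towerNum p Q s / towerDen p Q s = algebraMap (PowerSeries K) (LaurentSeries K) w := by
  have hinj := IsFractionRing.injective (PowerSeries K) (LaurentSeries K)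
  have hQ1 : 1 < Q := hQ ▸ Finite.one_lt_card
  have := Fintype.ofFinite K
  have hfix (a : K) : a ^ Q = a := by
    rw [← hQ, Nat.card_eq_fintype_card, FiniteField.pow_card]
  have key {N D : PowerSeries K} (hN : PowerSeries.constantCoeff N = 1)
      (hD : PowerSeries.constantCoeff D = 1) : algebraMap _ (LaurentSeries K) D ≠ 0 ∧
      ∃ w : PowerSeries K, PowerSeries.constantCoeff w = 1 ∧
        algebraMap _ (LaurentSeries K) N / algebraMap _ (LaurentSeries K) D =
          algebraMap (PowerSeries K) (LaurentSeries K) w := by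
    have hD0 : algebraMap _ (LaurentSeries K) D ≠ 0 := by
      refine (map_ne_zero_iff _ hinj).2 ?_
      rintro rfl
      simp at hD
    refine ⟨hD0, N * D⁻¹, by simp [hN, hD], ?_⟩
    rw [div_eq_iff hD0, ← map_mul, mul_assoc, PowerSeries.inv_mul_cancel _ (by simp [hD]), mul_one]
  -- For a power series, the constant term is fixed by the `Q`-th power, so `s ^ Q - s` has constant
  -- term `0`. For a pole, the inverse `v` of `s ^ Q - s` has constant term `0`, and clearing `v ^
  -- p` turns the quotient into `(v ^ p + 1) / (v ^ p + v ^ (p - 1) + 1)`.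
  by_cases hs : s ∈ seriesRing K
  · obtain ⟨f, rfl⟩ := mem_seriesRing.1 hs
    rw [← map_towerNum, ← map_towerDen]
    refine key ?_ ?_ <;> simp [towerNum, towerDen, hfix] <;> omega
  · have hs0 : s ≠ 0 := by rintro rfl; exact hs (zero_mem _)
    have hs' := inv_mem_nonunits_of_notMem hs
    obtain ⟨g, hg⟩ := mem_seriesRing.1 ((seriesRing K).nonunits_subset hs')
    rw [← hg, algebraMap_mem_nonunits_seriesRing] at hs'
    have hg0 : algebraMap _ (LaurentSeries K) g ≠ 0 := by rw [hg]; exact inv_ne_zero hs0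
    obtain rfl : s = (algebraMap _ _ g)⁻¹ := by rw [hg, inv_inv]
    set c := algebraMap _ (LaurentSeries K) g
    obtain ⟨q, rfl⟩ := Nat.exists_eq_add_of_lt hQ1
    -- With `p = 2 + l` the exponent `p - 1 = 1 + l` is visibly positive, so that `v ^ (p - 1)` has
    -- constant term `0`.
    obtain ⟨l, rfl⟩ := Nat.exists_eq_add_of_le hp
    set U : PowerSeries K := 1 - g ^ (q + 1)
    have hU : PowerSeries.constantCoeff U = 1 := by simp [U, hs']
    have hU0 : algebraMap _ (LaurentSeries K) U ≠ 0 := by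
      refine (map_ne_zero_iff _ hinj).2 fun h => ?_
      rw [h] at hU; simp at hU
    set v : PowerSeries K := g ^ (q + 2) * U⁻¹
    have hv : PowerSeries.constantCoeff v = 0 := by simp [v, hs']
    set V := algebraMap _ (LaurentSeries K) v with hVdef
    have hUV : V * algebraMap _ (LaurentSeries K) U = c ^ (q + 2) := by
      rw [hVdef, ← map_mul, mul_assoc, PowerSeries.inv_mul_cancel _ (by simp [hU]), mul_one, map_pow]
    have hv0 : V ≠ 0 := left_ne_zero_of_mul (hUV ▸ pow_ne_zero _ hg0)
    have huv : c⁻¹ ^ (1 + q + 1) - c⁻¹ = V⁻¹ := by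
      rw [← eq_div_iff hU0] at hUV
      rw [hUV, inv_div, map_sub, map_one, map_pow, eq_div_iff (pow_ne_zero _ hg0), sub_mul, inv_pow,
        show 1 + q + 1 = q + 2 by ring, inv_mul_cancel₀ (pow_ne_zero _ hg0), pow_succ' c (q + 1),
        inv_mul_cancel_left₀ hg0]
    have hN : towerNum (2 + l) (1 + q + 1) c⁻¹ =
        algebraMap _ (LaurentSeries K) (v ^ (2 + l) + 1) / V ^ (2 + l) := by
      rw [towerNum, huv, map_add, map_pow, map_one, inv_pow, eq_div_iff (pow_ne_zero _ hv0), add_mul,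
        inv_mul_cancel₀ (pow_ne_zero _ hv0), one_mul]
    have hD : towerDen (2 + l) (1 + q + 1) c⁻¹ =
        algebraMap _ (LaurentSeries K) (v ^ (2 + l) + v ^ (1 + l) + 1) / V ^ (2 + l) := by
      rw [towerDen, huv, map_add, map_add, map_pow, map_pow, map_one, inv_pow,
        eq_div_iff (pow_ne_zero _ hv0), add_mul, add_mul, inv_mul_cancel₀ (pow_ne_zero _ hv0), one_mul,
        show 2 + l = 1 + l + 1 by ring, pow_succ' V (1 + l), inv_mul_cancel_left₀ hv0]
    rw [hN, hD, div_div_div_cancel_right₀ (pow_ne_zero _ hv0)]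
    have := key (N := v ^ (2 + l) + 1) (D := v ^ (2 + l) + v ^ (1 + l) + 1) (by simp [hv])
      (by simp [hv])
    exact ⟨div_ne_zero this.1 (pow_ne_zero _ hv0), this.2⟩

lemma exists_ne_zero_pow_eq_div (hp : 2 ≤ p) (hQ : Nat.card K = Q) (hm : (m : K) ≠ 0)
    (s : LaurentSeries K) :
    ∃ r : LaurentSeries K, r ≠ 0 ∧ r ^ m = towerNum p Q s / towerDen p Q s := by
  obtain ⟨-, w, hw, h⟩ := towerDen_ne_zero_and_exists_div_eq hp hQ s
  obtain ⟨γ, h1, h2⟩ := exists_powerSeries_pow_eq hm w one_ne_zero (by rw [one_pow, hw])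
  refine ⟨algebraMap _ _ γ, ?_, by rw [← map_pow, h1, h]⟩
  refine (map_ne_zero_iff _ (IsFractionRing.injective (PowerSeries K) (LaurentSeries K))).2 ?_
  rintro rfl
  simp at h2

end Lifts

/-! ### Complete splitting by counting embeddings. -/

section Splitting

universe u

variable {K : Type u} [Field K] {E : Type u} {C : Type*} [Field E] [Field C]
  [Algebra E C] {p Q m i : ℕ} {t : E} {x : ℕ → C}

/-- A homomorphism to Laurent series over a finite field extends to the `i`-th field of the
tower, with `i` free choices of an `m`-th root of unity. -/
lemma HasLifts.exists_injective [Finite K] (h : HasLifts E p Q m t x i) (h0 : x 0 = algebraMap E C t)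
    (hp : 2 ≤ p) (hQ : Nat.card K = Q) (hm : (m : K) ≠ 0) (ψ : E →+* LaurentSeries K) :
    ∃ Φ : (Fin i → rootsOfUnity m K) → (towerField E x i →+* LaurentSeries K),
      Function.Injective Φ ∧ ∀ c, (Φ c).comp (algebraMap E (towerField E x i)) = ψ := by
  choose ρ hρ0 hρ using exists_ne_zero_pow_eq_div (K := K) hp hQ hm
  -- The default `1` for `j ≥ i` is harmless: only the values of `β` up to index `i` are compared.
  let ext (c : Fin i → rootsOfUnity m K) (j : ℕ) : rootsOfUnity m K :=
    if h : j < i then c ⟨j, h⟩ else 1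
  let β (c : Fin i → rootsOfUnity m K) (j : ℕ) : LaurentSeries K :=
    Nat.rec (ψ t) (fun j s => constSeries K ((ext c j : Kˣ) : K) * ρ s) j
  have hβ (c j) : β c (j + 1) = constSeries K ((ext c j : Kˣ) : K) * ρ (β c j) := rfl
  have hc (c : rootsOfUnity m K) : ((c : Kˣ) : K) ^ m = 1 := by
    rw [← Units.val_pow_eq_pow_val, (mem_rootsOfUnity m _).1 c.2, Units.val_one]
  choose Φ hΦ hΦβ using fun c => h (LaurentSeries K) ψ (β c) rfl fun j _ => by
    rw [hβ, mul_pow, hρ, ← map_pow, hc, map_one, one_mul]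
  refine ⟨Φ, fun c d hcd => ?_, fun c => RingHom.ext (hΦ c)⟩
  have hβcd (j : ℕ) (hj : j ≤ i) : β c j = β d j := by
    rw [← hΦβ c j hj (gen_mem_towerField h0 hj), hcd, hΦβ d j hj]
  ext ⟨j, hj⟩ : 1
  have h1 := hβcd (j + 1) hj
  rw [hβ, hβ, hβcd j hj.le] at h1
  have h2 := (constSeries K).injective (mul_right_cancel₀ (hρ0 _) h1)
  simpa [ext, hj] using Subtype.ext (Units.ext h2)

/-- A place given by an expansion splits completely if the expansion has enough extensions. -/
lemma splitsCompletely_of_injective {L : Type*} [Field L] [Algebra (RatFunc K) L] [Algebra K L]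
    [IsScalarTower K (RatFunc K) L] [FiniteDimensional (RatFunc K) L]
    [Algebra.IsSeparable (RatFunc K) L] {P : ValuationSubring (RatFunc K)}
    (hP : P ∈ places K (RatFunc K)) {ψ : RatFunc K →+* LaurentSeries K} (hψ : IsExpansion ψ)
    (hψP : (seriesRing K).comap ψ = P) {S : Type*} [Finite S]
    (hS : Nat.card S = Module.finrank (RatFunc K) L) {Φ : S → (L →+* LaurentSeries K)}
    (hΦ : Function.Injective Φ) (hΦψ : ∀ c, (Φ c).comp (algebraMap (RatFunc K) L) = ψ) :
    SplitsCompletely K (RatFunc K) L P := by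
  have := isDiscreteValuationRing_of_mem_places hP
  let : Algebra P L := ((algebraMap (RatFunc K) L).comp (algebraMap P (RatFunc K))).toAlgebra
  have : IsScalarTower P (RatFunc K) L := IsScalarTower.of_algebraMap_eq' rfl
  obtain ⟨h1, h2⟩ := finite_and_ncard_le_finrank (A := P) (E := RatFunc K) (L := L)
  have hsub : placesAbove K (RatFunc K) L P ⊆ {O : ValuationSubring L |
      ∀ a, algebraMap (RatFunc K) L a ∈ O ↔ a ∈ (algebraMap P (RatFunc K)).range} := by
    rintro O ⟨-, rfl⟩ a
    exact ⟨fun h => ⟨⟨a, h⟩, rfl⟩, fun ⟨b, hb⟩ => hb ▸ b.2⟩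
  have hfin := h1.subset hsub
  -- The upper bound is the fundamental identity; the embeddings, which induce distinct places, give
  -- the lower one.
  refine ⟨hfin, le_antisymm ((Set.ncard_le_ncard hsub h1).trans h2) ?_⟩
  have hmem (c) : (seriesRing K).comap (Φ c) ∈ placesAbove K (RatFunc K) L P := by
    have hcomap : ((seriesRing K).comap (Φ c)).comap (algebraMap (RatFunc K) L) = P := by
      rw [ValuationSubring.comap_comap, hΦψ, hψP]
    refine ⟨⟨fun h => hP.1 ?_, fun a => ?_⟩, hcomap⟩
    · rw [← hcomap, h]; rfl
    · rw [IsScalarTower.algebraMap_apply K (RatFunc K) L, ← ValuationSubring.mem_comap, hcomap]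
      exact hP.2 a
  rw [← hS, ← Set.ncard_univ]
  refine Set.ncard_le_ncard_of_injOn (fun c => (seriesRing K).comap (Φ c)) (fun c _ => hmem c)
    (fun c _ d _ hcd => hΦ (hψ.eq_of_comap_eq (hΦψ c) (hΦψ d) hcd)) hfin

end Splitting

/-! ### The full constant field. -/

section Constants

/-- A field that embeds into the field of Laurent series over `K` compatibly with the constants
has full constant field `K`. -/
lemma isFullConstantField_of_ringHom {K L : Type*} [Field K] [Field L] [Algebra K L]
    (Φ : L →+* LaurentSeries K) (hΦ : ∀ a, Φ (algebraMap K L a) = constSeries K a) :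
    IsFullConstantField K L := by
  have hK (a : K) : algebraMap K L a ∈ (seriesRing K).comap Φ := by
    rw [ValuationSubring.mem_comap, hΦ]; exact constSeries_mem a
  intro z hz
  have hzO := mem_of_isIntegral hK hz.isIntegral
  obtain ⟨f, hf⟩ := mem_seriesRing.1 hzO
  refine ⟨PowerSeries.constantCoeff f, ?_⟩
  set a := PowerSeries.constantCoeff f
  have h1 : z - algebraMap K L a ∈ ((seriesRing K).comap Φ).nonunits := by
    rw [mem_nonunits_comap, map_sub, hΦ, ← hf, constSeries, RingHom.comp_apply, ← map_sub,
      algebraMap_mem_nonunits_seriesRing]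
    simp [a]
  rw [ValuationSubring.mem_nonunits_iff_or] at h1
  -- The inverse of `z - a` is algebraic over `K` and so lies in the valuation ring; a nonunit with
  -- this property is `0`.
  have h2 := h1.resolve_right fun h => h (mem_of_isIntegral hK
    (hz.sub (isAlgebraic_algebraMap a)).inv.isIntegral)
  exact (sub_eq_zero.1 h2).symm

end Constants

/-! ### Existence of ramification. -/

section Ramified

/-- Index `1` would allow `y = a * o` with `a` from `E` and `o` a unit. Then `e / a ^ m` is a unit,
so the order `p` of `e` is a multiple of `m`, which is impossible. -/
lemma ramificationIndex_ne_one {E L Ω : Type*} [Field E] [Field L] [Field Ω] [Algebra E L]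
    (ψ : E →+* LaurentSeries Ω) {y : L} {e : E} {m p : ℕ} (hm : m ≠ 1) (hmp : m.Coprime p)
    (hp : p ≠ 0) (hy : y ^ m = algebraMap E L e) (he : (ψ e).order = p) {O : ValuationSubring L}
    (hO : O.comap (algebraMap E L) = (seriesRing Ω).comap ψ) : ramificationIndex E O ≠ 1 := by
  intro h
  have hmem (a : E) : ψ a ∈ seriesRing Ω ↔ algebraMap E L a ∈ O := by
    rw [← ValuationSubring.mem_comap, ← hO, ValuationSubring.mem_comap]
  have he0 : e ≠ 0 := by
    rintro rfl
    rw [map_zero, HahnSeries.order_zero] at he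
    omega
  have hm0 : m ≠ 0 := by
    rintro rfl
    have : e = 1 := by
      apply (algebraMap E L).injective; rw [← hy, pow_zero, map_one]
    rw [this, map_one, HahnSeries.order_one] at he
    omega
  have hy0 : y ≠ 0 := by
    rintro rfl
    rw [zero_pow hm0, eq_comm, map_eq_zero] at hy
    exact he0 hy
  rw [ramificationIndex, Subgroup.index_eq_one] at h
  have hyt : Units.mk0 y hy0 ∈ (⊤ : Subgroup Lˣ) := Subgroup.mem_top _
  rw [← h, Subgroup.mem_sup] at hyt
  obtain ⟨_, ⟨a, rfl⟩, o, ho, hao⟩ := hyt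
  have hao' : algebraMap E L a * o = y := congrArg Units.val hao
  have ha0 : (a : E) ≠ 0 := a.ne_zero
  have ho' := (mem_unitGroup_iff_mem O o).1 ho
  have hc : algebraMap E L (e / a ^ m) = (o : L) ^ m := by
    rw [map_div₀, ← hy, ← hao', map_pow, mul_pow, mul_div_cancel_left₀]
    exact pow_ne_zero _ ((_root_.map_ne_zero _).2 ha0)
  have hord := order_eq_zero_of_mem_of_inv_mem (z := ψ (e / a ^ m))
    ((hmem _).2 (hc ▸ pow_mem ho'.1 m))
    (by rw [← map_inv₀, hmem, map_inv₀, hc, ← inv_pow]; exact pow_mem ho'.2 m)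
    ((_root_.map_ne_zero _).2 (div_ne_zero he0 (pow_ne_zero _ ha0)))
  have h1 : ψ e = ψ (e / a ^ m) * ψ a ^ m := by
    rw [← map_pow, ← map_mul, div_mul_cancel₀ _ (pow_ne_zero _ ha0)]
  rw [h1, HahnSeries.order_mul ((_root_.map_ne_zero _).2 (div_ne_zero he0 (pow_ne_zero _ ha0)))
    (pow_ne_zero _ ((_root_.map_ne_zero _).2 ha0)), hord, zero_add, HahnSeries.order_pow, nsmul_eq_mul]
    at he
  have : (m : ℤ) ∣ p := ⟨_, he.symm⟩
  exact hm (Nat.eq_one_of_dvd_coprimes hmp dvd_rfl (Int.natCast_dvd_natCast.1 this))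

end Ramified

/-! ### Assembly over a finite field: roots of unity and properties of the tower. -/

section PrimitiveRoot

lemma exists_isPrimitiveRoot {K : Type*} [Field K] [Finite K] {m : ℕ} (hm : m ∣ Nat.card K - 1) :
    ∃ ζ : K, IsPrimitiveRoot ζ m := by
  obtain ⟨g, hg⟩ := IsCyclic.exists_ofOrder_eq_natCard (α := Kˣ)
  obtain ⟨k, hk⟩ := hm
  have h := IsPrimitiveRoot.orderOf g
  rw [hg] at h
  have h1 := h.pow Nat.card_pos (a := k) (b := m) (by rw [Nat.card_units, hk, mul_comm])
  exact ⟨_, IsPrimitiveRoot.coe_units_iff.2 h1⟩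

end PrimitiveRoot

section RatFuncTower

universe u

lemma natCast_ne_zero_of_coprime {p m : ℕ} [Fact p.Prime] (hmc : m.Coprime p) (R : Type*) [Ring R]
    [CharP R p] : (m : R) ≠ 0 := by
  rw [Ne, CharP.cast_eq_zero_iff R p]
  intro h
  exact (Fact.out : p.Prime).one_lt.ne' (Nat.eq_one_of_dvd_coprimes hmc h dvd_rfl)

/-- Coefficients are taken in the algebraic closure because the backward chain solves polynomial
equations for its starting values. -/
lemma hasSeriesHoms_ratFunc (K : Type u) [Field K] :
    HasSeriesHoms (RatFunc K) RatFunc.X (AlgebraicClosure K) := by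
  intro b hb
  obtain ⟨ψ, -, h⟩ := exists_ratFunc_hom_series (algebraMap K (AlgebraicClosure K)) hb
  exact ⟨ψ, h⟩

/-- There is a place of the rational function field at which the right hand side of the tower
equation has valuation `p`. -/
lemma exists_place_order_eq (K : Type u) [Field K] (p : ℕ) [Fact p.Prime] [CharP K p] {n m : ℕ}
    (hn : n ≠ 0) (hm : m ∣ p ^ n - 1) (hmc : m.Coprime p) :
    ∃ ψ : RatFunc K →+* LaurentSeries (AlgebraicClosure K),
      (seriesRing _).comap ψ ∈ places K (RatFunc K) ∧
      (ψ (towerNum p (p ^ n) RatFunc.X / towerDen p (p ^ n) RatFunc.X)).order = p := by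
  have : CharP (AlgebraicClosure K) p := charP_of_injective_algebraMap' K p
  have hmp' := natCast_ne_zero_of_coprime hmc (AlgebraicClosure K)
  obtain ⟨α, -, H⟩ := exists_powerSeries_chain (Ω := AlgebraicClosure K) p hn hm hmp' 0
  obtain ⟨β, h0, -, h2, r, hr, h3⟩ := H (PowerSeries.C α + PowerSeries.X) (by simp) (by simp)
  obtain ⟨ψ, hψ, hψX⟩ := exists_ratFunc_hom_series (algebraMap K (AlgebraicClosure K))
    (b := PowerSeries.C α + PowerSeries.X) (by simp)
  have hord : (ψ (towerNum p (p ^ n) RatFunc.X / towerDen p (p ^ n) RatFunc.X)).order = p := by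
    rw [map_div₀, map_towerNum, map_towerDen, hψX, ← h0, ← map_towerNum, ← map_towerDen]
    exact order_div_eq hr h3 (h2 0 le_rfl)
  refine ⟨ψ, ⟨fun htop => ?_, fun a => ?_⟩, hord⟩
  · set e := towerNum p (p ^ n) (RatFunc.X : RatFunc K) / towerDen p (p ^ n) RatFunc.X
    have hp := (Fact.out : p.Prime).ne_zero
    have hmem (z : RatFunc K) : ψ z ∈ seriesRing _ := by
      rw [← ValuationSubring.mem_comap, htop]; exact ValuationSubring.mem_top z
    have he : ψ e ≠ 0 := by
      intro h
      rw [h, HahnSeries.order_zero] at hord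
      omega
    have := order_eq_zero_of_mem_of_inv_mem (hmem e) (by rw [← map_inv₀]; exact hmem _) he
    omega
  · rw [ValuationSubring.mem_comap, hψ]; exact constSeries_mem _

/-- The tower of the equation `y ^ m = towerNum p (p ^ n) x / towerDen p (p ^ n) x` over the
rational function field over a field with `p ^ n` elements. -/
structure IsFiniteFieldTower (K : Type*) [Field K] (p n m : ℕ)
    (x : ℕ → AlgebraicClosure (RatFunc K)) : Prop where
  ne_zero : n ≠ 0
  dvd : m ∣ p ^ n - 1
  pos : 0 < m
  coprime : m.Coprime p
  card : Nat.card K = p ^ n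
  isTowerSeq : IsTowerSeq p (p ^ n) m (RatFunc.X : RatFunc K) x

namespace IsFiniteFieldTower

variable {K : Type u} [Field K] {p n m : ℕ} [Fact p.Prime] [CharP K p]
  {x : ℕ → AlgebraicClosure (RatFunc K)} (h : IsFiniteFieldTower K p n m x) (i : ℕ)

lemma charP_algebraicClosure (K : Type*) [Field K] (p : ℕ) [CharP K p] :
    CharP (AlgebraicClosure K) p :=
  charP_of_injective_algebraMap' K p

include h

lemma towerDen_ne_zero : towerDen p (p ^ n) (x i) ≠ 0 := by
  have := charP_algebraicClosure K p
  exact h.isTowerSeq.towerDen_ne_zero (AlgebraicClosure K) (hasSeriesHoms_ratFunc K) h.ne_zero h.dvd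
    (natCast_ne_zero_of_coprime h.coprime _) h.pos h.coprime i

lemma not_pow (hm1 : m ≠ 1) {w : AlgebraicClosure (RatFunc K)} (hw : w ∈ towerField (RatFunc K) x i) :
    towerNum p (p ^ n) (x i) / towerDen p (p ^ n) (x i) ≠ w ^ m := by
  have := charP_algebraicClosure K p
  exact h.isTowerSeq.not_pow (AlgebraicClosure K) (hasSeriesHoms_ratFunc K) h.ne_zero h.dvd
    (natCast_ne_zero_of_coprime h.coprime _) h.pos h.coprime hm1 i hw

lemma hasLifts : HasLifts (RatFunc K) p (p ^ n) m RatFunc.X x i := by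
  have := charP_algebraicClosure K p
  exact h.isTowerSeq.hasLifts (AlgebraicClosure K) (hasSeriesHoms_ratFunc K) h.ne_zero h.dvd
    (natCast_ne_zero_of_coprime h.coprime _) h.pos h.coprime i

lemma natDegree_minpoly :
    (minpoly (towerField (RatFunc K) x i) (x (i + 1))).natDegree = m := by
  have := charP_algebraicClosure K p
  exact h.isTowerSeq.natDegree_minpoly (AlgebraicClosure K) (hasSeriesHoms_ratFunc K) h.ne_zero h.dvd
    (natCast_ne_zero_of_coprime h.coprime _) h.pos h.coprime i

lemma finrank_towerField : Module.finrank (RatFunc K) (towerField (RatFunc K) x i) = m ^ i := by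
  have := charP_algebraicClosure K p
  exact h.isTowerSeq.finrank_towerField (AlgebraicClosure K) (hasSeriesHoms_ratFunc K) h.ne_zero h.dvd
    (natCast_ne_zero_of_coprime h.coprime _) h.pos h.coprime i

lemma finiteDimensional_towerField : FiniteDimensional (RatFunc K) (towerField (RatFunc K) x i) := by
  have := charP_algebraicClosure K p
  exact h.isTowerSeq.finiteDimensional_towerField (AlgebraicClosure K) (hasSeriesHoms_ratFunc K)
    h.ne_zero h.dvd (natCast_ne_zero_of_coprime h.coprime _) h.pos h.coprime i

variable [Finite K]

omit [Fact p.Prime] [CharP K p] in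
lemma exists_isPrimitiveRoot_towerField :
    ∃ ζ : towerField (RatFunc K) x i, IsPrimitiveRoot ζ m := by
  obtain ⟨ζ, hζ⟩ := exists_isPrimitiveRoot (K := K) (m := m) (by rw [h.card]; exact h.dvd)
  exact ⟨algebraMap K _ ζ, hζ.map_of_injective (algebraMap K (towerField (RatFunc K) x i)).injective⟩

lemma hasTamePlaces : HasTamePlaces K p (towerField (RatFunc K) x i) := by
  have hp := (Fact.out : p.Prime)
  induction i with
  | zero => exact hasTamePlaces_bot hp fun P hP => isDiscreteValuationRing_of_mem_places hP
  | succ i ih =>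
    obtain ⟨ζ, hζ⟩ := h.exists_isPrimitiveRoot_towerField i
    exact hasTamePlaces_sup_adjoin hp ih h.pos (fun hpm => hp.one_lt.ne'
      (Nat.eq_one_of_dvd_coprimes h.coprime hpm dvd_rfl)) (h.isTowerSeq.gen_pow_mem i)
      (h.natDegree_minpoly i) hζ

lemma isSeparable_towerField : Algebra.IsSeparable (RatFunc K) (towerField (RatFunc K) x i) := by
  induction i with
  | zero =>
    exact AlgEquiv.Algebra.isSeparable
      (IntermediateField.botEquiv (RatFunc K) (AlgebraicClosure (RatFunc K))).symm
  | succ i ih =>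
    obtain ⟨ζ, hζ⟩ := h.exists_isPrimitiveRoot_towerField i
    exact isSeparable_sup_adjoin ih h.pos (h.isTowerSeq.gen_pow_mem i) (h.natDegree_minpoly i) hζ

lemma exists_injective (ψ : RatFunc K →+* LaurentSeries K) :
    ∃ Φ : (Fin i → rootsOfUnity m K) → (towerField (RatFunc K) x i →+* LaurentSeries K),
      Function.Injective Φ ∧
      ∀ c, (Φ c).comp (algebraMap (RatFunc K) (towerField (RatFunc K) x i)) = ψ :=
  (h.hasLifts i).exists_injective h.isTowerSeq.zero (Fact.out : p.Prime).two_le h.card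
    (natCast_ne_zero_of_coprime h.coprime K) ψ

lemma isFullConstantField : IsFullConstantField K (towerField (RatFunc K) x i) := by
  obtain ⟨ψ, hψ, -⟩ := exists_isExpansion (0 : K)
  obtain ⟨Φ, -, hΦ⟩ := h.exists_injective i ψ
  refine isFullConstantField_of_ringHom (Φ 1) fun a => ?_
  rw [← hψ.map_const, ← hΦ 1]
  rfl

lemma splitsCompletely {P : ValuationSubring (RatFunc K)} (hP : P ∈ rationalPlaces K (RatFunc K)) :
    SplitsCompletely K (RatFunc K) (towerField (RatFunc K) x i) P := by
  have := h.finiteDimensional_towerField i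
  have := h.isSeparable_towerField i
  have : NeZero m := ⟨h.pos.ne'⟩
  have := Fintype.ofFinite (rootsOfUnity m K)
  obtain ⟨ψ, hψ, hψP⟩ := exists_isExpansion_comap_eq hP
  obtain ⟨Φ, hΦ, hΦψ⟩ := h.exists_injective i ψ
  obtain ⟨ζ, hζ⟩ := exists_isPrimitiveRoot (K := K) (m := m) (by rw [h.card]; exact h.dvd)
  refine splitsCompletely_of_injective hP.1 hψ hψP ?_ hΦ hΦψ
  rw [h.finrank_towerField, Nat.card_fun, hζ.card_rootsOfUnity, Nat.card_eq_fintype_card, Fintype.card_fin]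

lemma isTame : IsTame K (RatFunc K) (towerField (RatFunc K) x i) := fun O hO => by
  rw [ringChar.eq K p]
  exact (h.hasTamePlaces i O hO).2

lemma isRamified (hm1 : m ≠ 1) {i : ℕ} (hi : 0 < i) :
    IsRamified K (RatFunc K) (towerField (RatFunc K) x i) := by
  have hp := (Fact.out : p.Prime)
  obtain ⟨ψ, hψ, hord⟩ := exists_place_order_eq K p h.ne_zero h.dvd h.coprime
  obtain ⟨O, hO⟩ := exists_comap_eq (L := towerField (RatFunc K) x i) ((seriesRing _).comap ψ)
  have hOK : O ∈ places K (towerField (RatFunc K) x i) := by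
    refine ⟨fun htop => hψ.1 ?_, fun a => ?_⟩
    · rw [← hO, htop]; rfl
    · rw [IsScalarTower.algebraMap_apply K (RatFunc K), ← ValuationSubring.mem_comap, hO]
      exact hψ.2 a
  have hne := ramificationIndex_ne_one ψ (m := m)
    (y := (⟨x 1, gen_mem_towerField h.isTowerSeq.zero hi⟩ : towerField (RatFunc K) x i))
    hm1 h.coprime hp.ne_zero (by
      ext
      change x 1 ^ m = algebraMap _ _ _
      rw [h.isTowerSeq.succ 0, h.isTowerSeq.zero, ← map_towerNum, ← map_towerDen, ← map_div₀]) hord hO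
  -- Index `0` encodes infinite index; tameness excludes it since `p` divides `0`.
  have hne0 : ramificationIndex (RatFunc K) O ≠ 0 := fun h0 =>
    (h.hasTamePlaces i O hOK).2 (h0 ▸ dvd_zero p)
  exact ⟨O, hOK, by omega⟩

end IsFiniteFieldTower

lemma eval_towerNum_towerDen {K : Type*} [Field K] [Finite K] {p Q : ℕ} (hp : p ≠ 0)
    (hQ : Nat.card K = Q) (a : K) :
    (towerNum p Q (X : K[X])).eval a = 1 ∧ (towerDen p Q (X : K[X])).eval a = 1 := by
  have := Fintype.ofFinite K
  have ha : a ^ Q = a := by rw [← hQ, Nat.card_eq_fintype_card, FiniteField.pow_card]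
  simp [towerNum, towerDen, ha, hp]

/-- Here `m = 1 + p + ⋯ + p ^ (n - 1)`, which is `1` modulo `p` and exceeds `1` as soon as `n ≥ 2`.
-/
lemma dvd_and_coprime_of_mul_eq {p n m : ℕ} (hp : 2 ≤ p) (hn : 1 < n)
    (hm : m = (p ^ n - 1) / (p - 1)) : m ∣ p ^ n - 1 ∧ m.Coprime p ∧ 1 < m := by
  have hdvd : p - 1 ∣ p ^ n - 1 := by simpa using Nat.sub_dvd_pow_sub_pow p 1 n
  refine ⟨hm ▸ Nat.div_dvd_of_dvd hdvd, ?_⟩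
  rw [← Nat.geomSum_eq hp] at hm
  obtain ⟨k, rfl⟩ := Nat.exists_eq_add_of_le hn
  rw [show 1 + 1 + k = k + 1 + 1 by ring] at hm
  constructor
  · rw [hm, Finset.sum_range_succ', pow_zero]
    simp only [pow_succ, ← Finset.sum_mul]
    simp
  · rw [hm, Finset.sum_range_succ', Finset.sum_range_succ', pow_zero, zero_add, pow_one]
    omega

end RatFuncTower

end FunctionFieldTower

/-! ### The main theorem. -/

open FunctionFieldTower in
theorem mainTheorem9 (K : Type*) [Field K] [Finite K]
    (hprime : ¬ (Nat.card K).Prime) (hcard : 4 < Nat.card K) :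
    ∃ (q n : ℕ) (g h : K[X])
      (F : ℕ → IntermediateField (RatFunc K) (AlgebraicClosure (RatFunc K)))
      (x : ℕ → AlgebraicClosure (RatFunc K)),
      IsPrimePow q ∧ 1 < n ∧ Nat.card K = q ^ n ∧
      IsKummerTower n q g h F x ∧
      (∀ i, FiniteDimensional (RatFunc K) (F i) ∧
        Algebra.IsSeparable (RatFunc K) (F i) ∧
        IsFullConstantField K (F i) ∧
        IsTame K (RatFunc K) (F i) ∧
        (0 < i → IsRamified K (RatFunc K) (F i)) ∧
        ∀ P ∈ rationalPlaces K (RatFunc K), SplitsCompletely K (RatFunc K) (F i) P) ∧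
      ∀ N : ℕ, ∃ i, N ≤ Module.finrank (RatFunc K) (F i) := by
  have := Fintype.ofFinite K
  obtain ⟨p, hpchar⟩ := CharP.exists K
  obtain ⟨⟨n, hn0⟩, hp, hcardK⟩ := FiniteField.card K p
  rw [← Nat.card_eq_fintype_card, PNat.mk_coe] at hcardK
  have : Fact p.Prime := ⟨hp⟩
  have hn : 1 < n := by
    refine lt_of_le_of_ne hn0 fun h => hprime ?_
    rw [hcardK, ← h, pow_one]; exact hp
  obtain ⟨m, hm⟩ : ∃ m, m = (p ^ n - 1) / (p - 1) := ⟨_, rfl⟩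
  obtain ⟨hdvd, hcop, hm1⟩ := dvd_and_coprime_of_mul_eq hp.two_le hn hm
  obtain ⟨x, hx⟩ := exists_isTowerSeq (C := AlgebraicClosure (RatFunc K)) p (p ^ n)
    (zero_lt_one.trans hm1) (RatFunc.X : RatFunc K)
  have h : IsFiniteFieldTower K p n m x :=
    ⟨hn0.ne', hdvd, zero_lt_one.trans hm1, hcop, hcardK, hx⟩
  have hnum (i : ℕ) : aeval (x i) (towerNum p (p ^ n) (X : K[X])) = towerNum p (p ^ n) (x i) := by
    rw [map_towerNum, aeval_X]
  have hden (i : ℕ) : aeval (x i) (towerDen p (p ^ n) (X : K[X])) = towerDen p (p ^ n) (x i) := by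
    rw [map_towerDen, aeval_X]
  have heval := eval_towerNum_towerDen (K := K) hp.ne_zero hcardK
  -- The prime power `q` is the characteristic itself, so `n` is the degree of `K` over its prime
  -- field. The `N`-th field has degree `m ^ N`, which is at least `N`.
  refine ⟨p, n, towerNum p (p ^ n) X, towerDen p (p ^ n) X, towerField (RatFunc K) x, x,
    hp.isPrimePow, hn, hcardK, ?_, fun i => ⟨h.finiteDimensional_towerField i,
      h.isSeparable_towerField i, h.isFullConstantField i, h.isTame i, h.isRamified hm1.ne',
      fun P hP => h.splitsCompletely i hP⟩, fun N => ⟨N, ?_⟩⟩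
  · refine
      { quasiSymmetric_num := isQuasiSymmetric_towerNum K p n
        quasiSymmetric_den := isQuasiSymmetric_towerDen K p n
        num_no_zeros := fun a => by rw [(heval a).1]; exact one_ne_zero
        den_no_zeros := fun a => by rw [(heval a).2]; exact one_ne_zero
        degree_eq := degree_towerNum_eq_degree_towerDen K p (Nat.one_lt_pow hn0.ne' hp.one_lt)
        field_zero := rfl
        gen_zero := hx.zero
        field_succ := fun i => rfl
        den_ne_zero := fun i => by rw [hden]; exact h.towerDen_ne_zero i
        gen_succ := fun i => by rw [hnum, hden, ← hm]; exact hx.succ i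
        not_power := fun i w hw => by rw [hnum, hden, ← hm]; exact h.not_pow i hm1.ne' hw }
  · rw [h.finrank_towerField]
    exact (Nat.lt_pow_self hm1).le
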